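/- **Model.** A *configuration* of size $n$ is a triple $(G,\mathrm{id},I)$: a simple connected graph $G$ on $n$ nodes, injective identifiers $\mathrm{id}(v)\in\{1,\dots,n^c\}$, and labels $I(v)\in\{0,1\}^*$ of length at most $n^d$, for fixed constants $c\ge 1$, $d\ge 0$. A *$k$-round Arthur–Merlin protocol with shared randomness and bandwidth $b$* consists of $k$ alternating interactions, the last of which is Merlin's, and a verification round. In each of his $\lfloor k/2\rfloor$ turns Arthur draws a uniformly random string in $\{0,1\}^b$, the same for all nodes and known to Merlin. In each of his $\lceil k/2\rceil$ turns Merlin sends every node $v$ a certificate in $\{0,1\}^b$, which may depend on $v$, the configuration and the strings drawn so far. Then every node broadcasts to its neighbours one message in $\{0,1\}^b$, a function of its identifier, its label, the shared strings and its certificates, and accepts or rejects on the basis of these data and of the messages received from its neighbours (one per port, ports being ordered by the neighbours' identifiers). The protocol *decides* a language $\mathcal L$ on $n$-node configurations if for every configuration in $\mathcal L$ some Merlin makes all nodes accept with probability at least $2/3$, and for every configuration not in $\mathcal L$ and every Merlin, at least one node rejects with probability at least $2/3$. The protocol may be chosen separately for each $n$. We write $\mathcal L\in\mathsf{dAM}^{\mathrm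 s}[k,\Omega(g(n))]$ if there is a constant $a>0$ such that for all sufficiently large $n$ every such $k$-round protocol that decides $\mathcal L$ on $n$-node configurations has bandwidth $b\ge a\,g(n)$. **Statement.** Let $k\ge 1$ be fixed. Then each of the following languages is in $\mathsf{dAM}^{\mathrm s}[k,\Omega(\log n)]$: - SYMMETRY: $G$ has a non-trivial automorphism; - DIAMETER, for every fixed threshold $D\ge 2$: $G$ has diameter at most $D$; - $\overline{3\text{-COL}}$: $G$ is not 3-colourable; - $\triangle$-FREE: $G$ contains no triangle. Moreover $\mathrm{MST}\in\mathsf{dAM}^{\mathrm s}[k,\Omega(\log\log n)]$. Here $d\ge 1$, and the configurations considered are those in which the label of each node lists, for each incident edge, its weight, an integer in $\{1,\dots,n^{e}\}$ for a fixed constant $e\ge 1$, and whether the edge is marked (consistently at its two endpoints); the language consists of those in which the marked edges form a minimum-weight spanning tree of $G$. The constants in $\Omega$ depend only on $k$, $c$, $d$ and, where applicable, $D$ or $e$. -/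

import Mathlib

open Filter

namespace DistIP

/-! ### Network configurations and distributed languages -/

/-- A network configuration `(G, id, I)` on `n` nodes: a simple connected graph, a one-to-one
assignment of identifiers, and an input label in `{0,1}*` at every node. -/
structure Network (n : ℕ) where
  graph : SimpleGraph (Fin n)
  connected : graph.Connected
  ident : Fin n → ℕ
  ident_injective : Function.Injective ident
  input : Fin n → List Bool

/-- A distributed language, given by its `n`-node members for every `n`. -/
abbrev Language := ∀ n : ℕ, Set (Network n)

/-- The `n`-node configurations with identifiers in `{1, …, n ^ c}` and labels of length at most
`n ^ d`. -/
def polyNetworks (c d : ℕ) : Language := fun n =>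
  {x | (∀ v, 1 ≤ x.ident v ∧ x.ident v ≤ n ^ c) ∧ ∀ v, (x.input v).length ≤ n ^ d}

open Classical in
/-- The neighbours of `v`, one per port; ports are ordered by increasing identifier. -/
noncomputable def Network.ports {n : ℕ} (x : Network n) (v : Fin n) : List (Fin n) :=
  ((List.finRange n).filter fun u => x.graph.Adj v u).mergeSort
    fun u u' => decide (x.ident u ≤ x.ident u')

/-! ### Arthur–Merlin protocols with shared randomness -/

/-- Strings of `b` bits. -/
abbrev BitString (b : ℕ) := Fin b → Bool

/-- In `k` alternating interactions, of which Merlin has the last one, Arthur speaks `⌊k/2⌋` times.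
Each time a string of `b` bits, shared by all nodes, is drawn. -/
abbrev Coins (k b : ℕ) := Fin (k / 2) → BitString b

/-- The certificates received by one node: Merlin speaks `⌈k/2⌉` times. -/
abbrev Certs (k b : ℕ) := Fin ((k + 1) / 2) → BitString b

/-- A `k`-round verifier of bandwidth `b`: a deterministic one-round algorithm executed at each node.
A node first broadcasts `message` to its neighbours, computed from its identifier, its label, the
shared random strings and its certificates. It then outputs accept (`true`) or reject (`false`), from
the same data and the list of messages received through its ports. -/
structure Verifier (k b : ℕ) where
  message : ℕ → List Bool → Coins k b → Certs k b → BitString b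
  verdict : ℕ → List Bool → Coins k b → Certs k b → List (BitString b) → Bool

/-- A prover on `n` nodes. `cert r j v` is Merlin's `j`-th certificate for the node `v` when the
shared strings are `r`; it depends only on the strings drawn before that certificate is sent. These
are the strings `i ≤ j` if Arthur starts (`k` even) and the strings `i < j` if Merlin starts
(`k` odd), counting from `0`. -/
structure Prover (k b n : ℕ) where
  cert : Coins k b → Fin ((k + 1) / 2) → Fin n → BitString b
  causal : ∀ (r r' : Coins k b) (j : Fin ((k + 1) / 2)),
    (∀ i : Fin (k / 2), (i : ℕ) + k % 2 ≤ (j : ℕ) → r i = r' i) → cert r j = cert r' j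

/-- All nodes accept when the shared strings are `r`. -/
def Verifier.AllAccept {k b n : ℕ} (V : Verifier k b) (x : Network n) (M : Prover k b n)
    (r : Coins k b) : Prop :=
  ∀ v : Fin n,
    V.verdict (x.ident v) (x.input v) r (fun j => M.cert r j v)
      ((x.ports v).map fun u =>
        V.message (x.ident u) (x.input u) r (fun j => M.cert r j u)) = true

open Classical in
/-- The probability of an event over uniformly random shared strings. -/
noncomputable def coinProb {k b : ℕ} (E : Coins k b → Prop) : ℝ :=
  ((Finset.univ.filter E).card : ℝ) / (Fintype.card (Coins k b) : ℝ)

/-- `V` decides `L` with error `ε` on the `n`-node configurations in `P`. -/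
def Verifier.Decides {k b n : ℕ} (V : Verifier k b) (ε : ℝ) (P L : Set (Network n)) : Prop :=
  ∀ x ∈ P,
    (x ∈ L → ∃ M : Prover k b n, 1 - ε ≤ coinProb (V.AllAccept x M)) ∧
    (x ∉ L → ∀ M : Prover k b n, 1 - ε ≤ coinProb fun r => ¬ V.AllAccept x M r)

/-- `L ∈ dAMˢ_ε[k, Ω(g(n))]` over the configurations in `P`: for all large `n`, every `k`-round
verifier with shared randomness that decides `L` with error `ε` on `n`-node configurations has
bandwidth at least a constant times `g n`. The verifier may be chosen separately for every `n`. -/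
def NeedsBandwidth (ε : ℝ) (k : ℕ) (P L : Language) (g : ℕ → ℝ) : Prop :=
  ∃ a : ℝ, 0 < a ∧ ∀ᶠ n : ℕ in atTop, ∀ (b : ℕ) (V : Verifier k b),
    V.Decides ε (P n) (L n) → a * g n ≤ (b : ℝ)

/-! ### The languages -/

/-- Graphs with a non-trivial automorphism. -/
def symmetryLang : Language := fun _ => {x | ∃ φ : x.graph ≃g x.graph, ∃ v, φ v ≠ v}

/-- Graphs of diameter at most `D`. -/
def diameterLang (D : ℕ) : Language := fun _ => {x | ∀ u v, x.graph.dist u v ≤ D}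

/-- Graphs that are not 3-colourable. -/
def nonThreeColLang : Language := fun _ => {x | ¬ x.graph.Colorable 3}

/-- Graphs without triangles. -/
def triangleFreeLang : Language := fun _ => {x | x.graph.CliqueFree 3}

/-- A list of pairs (number, mark) as a bit string: each binary digit `t` of the number (least
significant first) is written `1 t`, and the number is closed by `0` followed by the mark. -/
def encodeLabel (l : List (ℕ × Bool)) : List Bool :=
  l.flatMap fun p => (p.1.bits.flatMap fun t => [true, t]) ++ [false, p.2]

open Classical in
/-- The labels of `x` encode the edge weights `w` and the subgraph `T`: the label of `v` lists, port by
port, the weight of the edge behind the port and whether that edge belongs to `T`. -/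
def EncodesWeighted {n : ℕ} (x : Network n) (w : Sym2 (Fin n) → ℕ) (T : SimpleGraph (Fin n)) :
    Prop :=
  T ≤ x.graph ∧
    ∀ v, x.input v = encodeLabel ((x.ports v).map fun u => (w s(v, u), decide (T.Adj v u)))

open Classical in
/-- The total weight of the edges of `T`. -/
noncomputable def totalWeight {n : ℕ} (w : Sym2 (Fin n) → ℕ) (T : SimpleGraph (Fin n)) : ℕ :=
  ∑ e ∈ T.edgeFinset, w e

/-- `T` is a minimum-weight spanning tree of `G`. -/
def IsMinSpanningTree {n : ℕ} (G : SimpleGraph (Fin n)) (w : Sym2 (Fin n) → ℕ)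
    (T : SimpleGraph (Fin n)) : Prop :=
  T ≤ G ∧ T.IsTree ∧
    ∀ T' : SimpleGraph (Fin n), T' ≤ G → T'.IsTree → totalWeight w T ≤ totalWeight w T'

/-- Configurations whose labels encode edge weights and a set of marked edges, such that the marked
edges form a minimum spanning tree. -/
def mstLang : Language := fun _ =>
  {x | ∃ w T, EncodesWeighted x w T ∧ IsMinSpanningTree x.graph w T}

/-- The configurations of `polyNetworks c d` whose labels encode a set of marked edges and edge
weights in `{1, …, n ^ e}`. -/
def weightedNetworks (c d e : ℕ) : Language := fun n =>
  {x | x ∈ polyNetworks c d n ∧ ∃ w T, EncodesWeighted x w T ∧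
    ∀ s ∈ x.graph.edgeSet, 1 ≤ w s ∧ w s ≤ n ^ e}

end DistIP

namespace DistIP

/-! ### Signatures of yes-instances -/

/-! All five bounds come from one cut-and-paste argument. Fix a successful prover for each
yes-instance and record its signature: the set of accepted coin sequences and the messages that the
nodes of `W` send for every coin sequence. There are at most `2 ^ (2 ^ (b * (k / 2 + 1)) * |W|)`
signatures. Suppose that each node `v` of a network `y` has the same local input and the same
neighbours as in some yes-instance `x v`, that all `x v` share one signature, and that `x v = x u`
for every neighbour `u` of `v` outside `W`. Let each `v` use the certificates of the prover for `x
v`. Then `v` sees in `y` what it sees in `x v`, so all nodes accept with probability at least 2/3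
and `y` must be a yes-instance (`Verifier.Decides.exists_signature`). Randomness and interaction do
not help, since a signature covers all coin sequences; the price is that `b` enters doubly
exponentially, and so the bounds are logarithmic.

Two-party fooling sets (`Verifier.Decides.card_le_of_fooling`) give four of the bounds. For
symmetry, diameter and non-3-colourability, each player holds `m * m` bits with `m` linear in `n`,
and `W` is everything. The comparison of `m * m` with `2 ^ O(b) * n` leaves `n ≤ 2 ^ O(b)` up to a
constant factor. For spanning trees, the network is a cycle with two variable weights, held by
players separated by a cut with four endpoints. This gives `n` inputs against `2 ^ (4 * 2 ^ O(b))`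
signatures, hence `log log n`.

Triangles need three players: a vertex of a potential triangle sees the two edges at it but not the
opposite one, as in the number-on-forehead model. Behrend's progression-free sets provide `N *
rothNumberNat N ≥ N ^ (3/2)` edge-disjoint triangles on `O(N)` vertices without accidental ones
(`exists_noAccident`). Triangle-freeness then encodes three-party disjointness on that many
coordinates. A discrepancy estimate, resting on `15 ^ 2 = 225 > 224`, shows that too few signatures
leave three yes-instances with equal signatures that recombine into a no-instance
(`exists_monochromatic_star`). -/

/-- What is recorded about an accepted instance: the accepted coins and the messages of the
vertices in `W`. -/
abbrev Signature (k b : ℕ) {n : ℕ} (W : Finset (Fin n)) :=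
  (Coins k b → Bool) × (W → Coins k b → BitString b)

/-- With `N = 2 ^ (b * (k / 2))` coin sequences, a signature consists of `N + b * N * |W|` bits. The
inequality `1 + b ≤ 2 ^ b` moves the factor `b` into the exponent. -/
theorem card_signature_le (k b : ℕ) {n : ℕ} (W : Finset (Fin n)) (hW : W.Nonempty) :
    Fintype.card (Signature k b W) ≤ 2 ^ (2 ^ (b * (k / 2 + 1)) * W.card) := by
  have hN : Fintype.card (Coins k b) = 2 ^ (b * (k / 2)) := by
    simp [Coins, BitString, pow_mul]
  have h1 : Fintype.card (Signature k b W)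
      = 2 ^ (2 ^ (b * (k / 2)) + b * 2 ^ (b * (k / 2)) * W.card) := by
    have hB : Fintype.card (BitString b) = 2 ^ b := by simp [BitString]
    have gen : ∀ (α β : Type) [Fintype α] [DecidableEq α] [Fintype β],
        Fintype.card ((α → Bool) × (W → α → β)) =
          2 ^ Fintype.card α * ((Fintype.card β ^ Fintype.card α) ^ W.card) := by
      intros
      simp
    refine (gen (Coins k b) (BitString b)).trans ?_
    rw [hN, hB, pow_add, ← pow_mul 2 b, ← pow_mul 2 (b * _)]
  rw [h1]
  apply Nat.pow_le_pow_right (by norm_num)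
  have h2 : 1 + b ≤ 2 ^ b := by have := b.lt_two_pow_self; omega
  have h3 : 1 ≤ W.card := hW.card_pos
  calc 2 ^ (b * (k / 2)) + b * 2 ^ (b * (k / 2)) * W.card
      ≤ 2 ^ (b * (k / 2)) * W.card + b * 2 ^ (b * (k / 2)) * W.card := by
        gcongr; exact Nat.le_mul_of_pos_right _ h3
    _ = 2 ^ (b * (k / 2)) * (1 + b) * W.card := by ring
    _ ≤ 2 ^ (b * (k / 2)) * 2 ^ b * W.card := by gcongr
    _ = _ := by rw [mul_add, pow_add, mul_one]

open Classical in
theorem ports_congr {n : ℕ} {x y : Network n} (hid : x.ident = y.ident) {v : Fin n}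
    (h : ∀ u, x.graph.Adj v u ↔ y.graph.Adj v u) : x.ports v = y.ports v := by
  have : (fun u => decide (x.graph.Adj v u)) = fun u => decide (y.graph.Adj v u) := by
    funext u
    simp only [h]
  unfold Network.ports
  rw [hid, this]

theorem mem_ports {n : ℕ} (x : Network n) {v u : Fin n} : u ∈ x.ports v ↔ x.graph.Adj v u := by
  classical
  simp [Network.ports]

/-- The hybrid of provers, vertex by vertex. -/
def hybridProver {k b n : ℕ} (M : Fin n → Prover k b n) : Prover k b n where
  cert r j v := (M v).cert r j v
  -- Causality is a condition at each node separately, so it survives mixing.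
  causal r r' j h := by
    funext v
    exact congrFun ((M v).causal r r' j h) v

theorem coinProb_not {k b : ℕ} (E : Coins k b → Prop) :
    coinProb (fun r => ¬ E r) = 1 - coinProb E := by
  have hpos : (0 : ℝ) < Fintype.card (Coins k b) := by exact_mod_cast Fintype.card_pos
  classical
  have h := Finset.card_filter_add_card_filter_not (s := (Finset.univ : Finset (Coins k b))) E
  rw [Finset.card_univ] at h
  unfold coinProb
  rw [eq_sub_iff_add_eq, ← add_div, div_eq_one_iff_eq hpos.ne']
  rw [← h]
  push_cast
  rw [add_comm]
  congr!

/-- The cut-and-paste principle: yes-instances with the same signature can be recombined. -/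
theorem Verifier.Decides.exists_signature {k b n : ℕ} {V : Verifier k b} {P L : Set (Network n)}
    (hV : V.Decides (1 / 3) P L) (W : Finset (Fin n)) :
    ∃ sig : Network n → Signature k b W, ∀ (y : Network n) (x : Fin n → Network n), y ∈ P →
      (∀ v, x v ∈ P ∧ x v ∈ L) → (∀ v, (x v).ident = y.ident) →
      (∀ v, (x v).input v = y.input v) →
      (∀ v u, (x v).graph.Adj v u ↔ y.graph.Adj v u) →
      (∀ v w, sig (x v) = sig (x w)) →
      (∀ v u, y.graph.Adj v u → u ∉ W → x v = x u) → y ∈ L := by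
  classical
  have hM : ∀ x : Network n, ∃ M : Prover k b n, x ∈ P → x ∈ L →
      1 - 1 / 3 ≤ coinProb (V.AllAccept x M) := by
    intro x
    by_cases hx : x ∈ P ∧ x ∈ L
    · obtain ⟨M, hM⟩ := (hV x hx.1).1 hx.2
      exact ⟨M, fun _ _ => hM⟩
    -- Other networks get an arbitrary causal prover, so that signatures are defined everywhere.
    · exact ⟨⟨fun _ _ _ _ => false, fun _ _ _ _ => rfl⟩, fun h h' => absurd ⟨h, h'⟩ hx⟩
  choose M hM using hM
  refine ⟨fun x => (fun r => decide (V.AllAccept x (M x) r), fun u r =>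
    V.message (x.ident u) (x.input u) r (fun j => (M x).cert r j u)), ?_⟩
  intro y x hy hx hid hin hadj hsig hW
  by_contra hyL
  rcases isEmpty_or_nonempty (Fin n) with hn | ⟨⟨v₀⟩⟩
  · exact (y.connected.nonempty.elim fun v => hn.elim v)
  -- The accepted coins agree exactly for all `x v`, so no union bound over the nodes is needed.
  have hall : ∀ r, V.AllAccept (x v₀) (M (x v₀)) r →
      V.AllAccept y (hybridProver fun v => M (x v)) r := by
    intro r hr v
    have hrv : V.AllAccept (x v) (M (x v)) r := by
      have := congrFun (congrArg Prod.fst (hsig v v₀)) r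
      simp only [decide_eq_decide] at this
      exact this.2 hr
    have h := hrv v
    rw [hid v, hin v, ports_congr (hid v) (hadj v)] at h
    refine Eq.trans ?_ h
    refine congrArg (V.verdict _ _ _ _) ?_
    apply List.map_congr_left
    intro u hu
    rw [mem_ports] at hu
    simp only [hybridProver]
    -- In `y` the neighbour `u` sends its message from `x u`. This is its message in `x v`, either
    -- because the signatures record it or because the two networks coincide.
    by_cases huW : u ∈ W
    · have := congrFun (congrFun (congrArg Prod.snd (hsig u v)) ⟨u, huW⟩) r
      simp only [hid] at this
      rw [← hin u]
      exact this
    · rw [← hin u, hW v u hu huW]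
  have h1 := hM (x v₀) (hx v₀).1 (hx v₀).2
  have h2 := (hV y hy).2 hyL (hybridProver fun v => M (x v))
  rw [coinProb_not] at h2
  have h3 : coinProb (V.AllAccept (x v₀) (M (x v₀))) ≤
      coinProb (V.AllAccept y (hybridProver fun v => M (x v))) := by
    unfold coinProb
    gcongr
    exact fun h => hall _ h
  linarith

/-- Two-party fooling sets: in `F s t` the first party holds `s` and the second one `t`. -/
theorem Verifier.Decides.card_le_of_fooling {k b n : ℕ} {V : Verifier k b} {P L : Set (Network n)}
    (hV : V.Decides (1 / 3) P L) {W : Finset (Fin n)} (hW : W.Nonempty) {ι : Type*} [Fintype ι]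
    (F : ι → ι → Network n) (alice : Fin n → Prop)
    (hP : ∀ s t, F s t ∈ P) (hyes : ∀ s, F s s ∈ L)
    (hno : ∀ s t, F s t ∈ L → F t s ∈ L → s = t)
    (hid : ∀ s t s' t', (F s t).ident = (F s' t').ident)
    (hinA : ∀ s t t' v, alice v → (F s t).input v = (F s t').input v)
    (hinB : ∀ s s' t v, ¬ alice v → (F s t).input v = (F s' t).input v)
    (hadjA : ∀ s t t' v u, alice v → ((F s t).graph.Adj v u ↔ (F s t').graph.Adj v u))
    (hadjB : ∀ s s' t v u, ¬ alice v → ((F s t).graph.Adj v u ↔ (F s' t).graph.Adj v u))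
    (hcut : ∀ s t v u, (F s t).graph.Adj v u → u ∉ W → (alice v ↔ alice u)) :
    Fintype.card ι ≤ 2 ^ (2 ^ (b * (k / 2 + 1)) * W.card) := by
  classical
  obtain ⟨sig, hsig⟩ := hV.exists_signature W
  refine le_trans ?_ (card_signature_le k b W hW)
  apply Fintype.card_le_of_injective fun s => sig (F s s)
  -- One player's nodes simulate `F s s` and the other's `F t t`; only edges across the cut join
  -- different simulations.
  have key : ∀ s t, sig (F s s) = sig (F t t) → F s t ∈ L := by
    intro s t hst
    apply hsig (F s t) (fun v => if alice v then F s s else F t t) (hP s t)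
    · intro v
      split_ifs
      exacts [⟨hP _ _, hyes _⟩, ⟨hP _ _, hyes _⟩]
    · intro v
      split_ifs
      exacts [hid _ _ _ _, hid _ _ _ _]
    · intro v
      split_ifs with h
      exacts [hinA _ _ _ _ h, hinB _ _ _ _ h]
    · intro v u
      split_ifs with h
      exacts [hadjA _ _ _ _ _ h, hadjB _ _ _ _ _ h]
    · intro v w
      split_ifs
      exacts [rfl, hst, hst.symm, rfl]
    · intro v u h hu
      simp only [hcut s t v u h hu]
  intro s t hst
  exact hno s t (key s t hst) (key t s hst.symm)

/-! ### Networks without labels -/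

/-- The network with graph `G`, identifiers `1, …, n` along `e`, and empty labels. -/
def unlabelled {n : ℕ} {V : Type*} (e : V ≃ Fin n) (G : SimpleGraph V) (hG : G.Connected) :
    Network n where
  graph := G.comap e.symm
  connected := (SimpleGraph.Iso.connected_iff (SimpleGraph.Iso.comap e.symm G)).2 hG
  ident v := v + 1
  ident_injective := fun v w h => Fin.ext (by simpa using h)
  input _ := []

theorem unlabelled_mem_polyNetworks {n : ℕ} {V : Type*} (e : V ≃ Fin n) (G : SimpleGraph V)
    (hG : G.Connected) {c : ℕ} (d : ℕ) (hc : 1 ≤ c) : unlabelled e G hG ∈ polyNetworks c d n := by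
  refine ⟨fun v => ⟨by simp [unlabelled], ?_⟩, fun v => by simp [unlabelled]⟩
  have : n ≤ n ^ c := Nat.le_self_pow (by omega) n
  have := v.2
  simp only [unlabelled]
  omega

/-- The isomorphism from `G` to the graph of `unlabelled e G hG`. -/
def unlabelledIso {n : ℕ} {V : Type*} (e : V ≃ Fin n) (G : SimpleGraph V) (hG : G.Connected) :
    (unlabelled e G hG).graph ≃g G := SimpleGraph.Iso.comap e.symm G

/-- Fooling sets of graphs without labels, all messages being recorded. -/
theorem Verifier.Decides.card_le_of_graph_fooling {k b n c d : ℕ} (hc : 1 ≤ c)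
    {V : Verifier k b} {L : Set (Network n)} (hV : V.Decides (1 / 3) (polyNetworks c d n) L)
    {U : Type*} (e : U ≃ Fin n) [Nonempty U] {ι : Type*} [Fintype ι]
    (G : ι → ι → SimpleGraph U) (alice : U → Prop) (hG : ∀ s t, (G s t).Connected)
    (hyes : ∀ s, unlabelled e (G s s) (hG s s) ∈ L)
    (hno : ∀ s t, unlabelled e (G s t) (hG s t) ∈ L → unlabelled e (G t s) (hG t s) ∈ L → s = t)
    (hadjA : ∀ s t t' v u, alice v → ((G s t).Adj v u ↔ (G s t').Adj v u))
    (hadjB : ∀ s s' t v u, ¬ alice v → ((G s t).Adj v u ↔ (G s' t).Adj v u)) :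
    Fintype.card ι ≤ 2 ^ (2 ^ (b * (k / 2 + 1)) * n) := by
  have hne : (Finset.univ : Finset (Fin n)).Nonempty :=
    ⟨e (Classical.arbitrary U), Finset.mem_univ _⟩
  have := hV.card_le_of_fooling hne (fun s t => unlabelled e (G s t) (hG s t))
    (fun v => alice (e.symm v)) (fun s t => unlabelled_mem_polyNetworks e _ _ d hc) hyes hno
    (fun _ _ _ _ => rfl) (fun _ _ _ _ _ => rfl) (fun _ _ _ _ _ => rfl)
    (fun s t t' v u h => hadjA s t t' _ _ h) (fun s s' t v u h => hadjB s s' t _ _ h)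
    (fun _ _ _ u _ hu => absurd (Finset.mem_univ u) hu)
  simpa using this

/-! ### From cardinalities to bandwidth -/

/-- Halving the constant absorbs `C` once `g n ≥ 2 * C / a`. -/
theorem needsBandwidth_of_eventually_le {k : ℕ} {P L : Language} {g : ℕ → ℝ}
    (hg : Tendsto g atTop atTop) {a C K : ℝ} (ha : 0 < a) (hK : 0 < K)
    (h : ∀ᶠ n : ℕ in atTop, ∀ (b : ℕ) (V : Verifier k b), V.Decides (1 / 3) (P n) (L n) →
      a * g n - C ≤ K * b) : NeedsBandwidth (1 / 3) k P L g := by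
  refine ⟨a / (2 * K), by positivity, ?_⟩
  filter_upwards [h, hg.eventually_ge_atTop (2 * C / a)] with n hn hgn b V hV
  have h1 := hn b V hV
  have h2 : C ≤ a * g n / 2 := by
    rw [div_le_iff₀ ha] at hgn
    linarith
  rw [div_mul_eq_mul_div, div_le_iff₀ (by positivity)]
  linarith

/-- A polynomial lower bound on `2 ^ (O(b))` gives a logarithmic lower bound on `b`. -/
theorem needsBandwidth_log_of_rpow_le {k : ℕ} {P L : Language} {a δ : ℝ} (K : ℕ) (ha : 0 < a)
    (hδ : 0 < δ) (hK : 0 < K)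
    (h : ∀ᶠ n : ℕ in atTop, ∀ (b : ℕ) (V : Verifier k b), V.Decides (1 / 3) (P n) (L n) →
      a * (n : ℝ) ^ δ ≤ 2 ^ (b * K)) : NeedsBandwidth (1 / 3) k P L (fun n => Real.log n) := by
  apply needsBandwidth_of_eventually_le (a := δ) (C := -Real.log a) (K := K * Real.log 2)
    (Real.tendsto_log_atTop.comp tendsto_natCast_atTop_atTop) hδ
    (mul_pos (by exact_mod_cast hK) (Real.log_pos (by norm_num)))
  filter_upwards [h, eventually_gt_atTop 0] with n hn hn0 b V hV
  have hn0' : (0 : ℝ) < n := by exact_mod_cast hn0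
  have h1 := Real.log_le_log (by positivity) (hn b V hV)
  rw [Real.log_mul ha.ne' (by positivity), Real.log_rpow hn0', Real.log_pow] at h1
  push_cast at h1
  simp only [Function.comp_apply]
  linarith

theorem needsBandwidth_log_of_sq_le {k : ℕ} {P L : Language} (K B : ℕ) (hK : 0 < K) (hB : 0 < B)
    (h : ∀ᶠ n : ℕ in atTop, ∀ (b : ℕ) (V : Verifier k b), V.Decides (1 / 3) (P n) (L n) →
      ∃ m : ℕ, n ≤ B * m ∧ 2 ^ (m * m) ≤ 2 ^ (2 ^ (b * K) * n)) :
    NeedsBandwidth (1 / 3) k P L (fun n => Real.log n) := by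
  apply needsBandwidth_log_of_rpow_le (a := 1 / (B : ℝ) ^ 2) (δ := 1) K (by positivity) one_pos hK
  filter_upwards [h, eventually_gt_atTop 0] with n hn hn0 b V hV
  obtain ⟨m, hm, h2⟩ := hn b V hV
  have h3 : m * m ≤ 2 ^ (b * K) * n := (Nat.pow_le_pow_iff_right (by norm_num)).1 h2
  have h4 : n * n ≤ B ^ 2 * 2 ^ (b * K) * n := by
    calc n * n ≤ (B * m) * (B * m) := Nat.mul_le_mul hm hm
      _ = B ^ 2 * (m * m) := by ring
      _ ≤ B ^ 2 * (2 ^ (b * K) * n) := by gcongr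
      _ = _ := by ring
  have h5 : n ≤ B ^ 2 * 2 ^ (b * K) := Nat.le_of_mul_le_mul_right h4 hn0
  rw [Real.rpow_one, div_mul_eq_mul_div, one_mul, div_le_iff₀ (by positivity)]
  calc (n : ℝ) ≤ ((B ^ 2 * 2 ^ (b * K) : ℕ) : ℝ) := by exact_mod_cast h5
    _ = _ := by push_cast; ring

/-! ### Diameter -/

theorem le_add_dist_of_adj {V : Type*} {G : SimpleGraph V} (hG : G.Connected) {f : V → ℕ}
    (hf : ∀ u v, G.Adj u v → f v ≤ f u + 1) (u v : V) : f v ≤ f u + G.dist u v := by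
  obtain ⟨w, hw⟩ := hG.exists_walk_length_eq_dist u v
  rw [← hw]
  clear hw
  induction w with
  | nil => simp
  | cons h p ih =>
    have := hf _ _ h
    rw [SimpleGraph.Walk.length_cons]
    omega

theorem dist_le_one_of_adj {V : Type*} {G : SimpleGraph V} {u v : V} (h : G.Adj u v) :
    G.dist u v ≤ 1 := (SimpleGraph.dist_eq_one_iff_adj.2 h).le

theorem dist_le_two_of_adj {V : Type*} {G : SimpleGraph V} (hG : G.Connected) {u v w : V}
    (h : G.Adj u v) (h' : G.Adj v w) : G.dist u w ≤ 2 := by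
  have := hG.dist_triangle (u := u) (v := v) (w := w)
  have := dist_le_one_of_adj h
  have := dist_le_one_of_adj h'
  omega

/-- Vertices of the diameter construction: `m` left tails of length `p`, `m` right tails of length
`q`, `2 * m` middle vertices, and `r` spare ones. -/
inductive DiamVertex (m p q r : ℕ)
  | left (i : Fin m) (t : Fin (p + 1))
  | right (j : Fin m) (t : Fin (q + 1))
  | mid (j : Fin m)
  | mid' (i : Fin m)
  | spare (a : Fin r)
  deriving DecidableEq, Fintype

namespace DiamVertex

variable {m p q r : ℕ}

theorem card : Fintype.card (DiamVertex m p q r) = m * (p + q + 4) + r := by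
  rw [← Fintype.card_congr (proxy_equiv% (DiamVertex m p q r))]
  simp
  ring

/-- The edges of the diameter construction, each in one direction. -/
def rel (x y : Fin m → Fin m → Bool) : DiamVertex m p q r → DiamVertex m p q r → Prop
  | left i t, left i' t' => (i = i' ∧ (t : ℕ) + 1 = t') ∨ ((t : ℕ) = 0 ∧ (t' : ℕ) = 0)
  | left i t, mid' i' => (t : ℕ) = 0 ∧ i = i'
  -- The bit `x i j` opens the route of length two from left `i` to right `j` through `mid j`.
  | left i t, mid j => (t : ℕ) = 0 ∧ x i j = true
  | left _ t, spare _ => (t : ℕ) = 0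
  | right j t, right j' t' => (j = j' ∧ (t : ℕ) + 1 = t') ∨ ((t : ℕ) = 0 ∧ (t' : ℕ) = 0)
  | right j t, mid j' => (t : ℕ) = 0 ∧ j = j'
  -- The negated bit of `y` opens the alternative route through `mid' i`.
  | right j t, mid' i => (t : ℕ) = 0 ∧ y i j = false
  | mid _, mid' _ => True
  | mid _, spare _ => True
  | _, _ => False

/-- The graph of the diameter construction. -/
def graph (x y : Fin m → Fin m → Bool) : SimpleGraph (DiamVertex m p q r) :=
  SimpleGraph.fromRel (rel x y)

variable {x y : Fin m → Fin m → Bool}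

theorem left_tail (i : Fin m) (t : ℕ) (ht : t + 1 < p + 1) :
    (graph x y).Adj (left i ⟨t, by omega⟩ : DiamVertex m p q r) (left i ⟨t + 1, ht⟩) := by
  simp [graph, rel]

theorem right_tail (j : Fin m) (t : ℕ) (ht : t + 1 < q + 1) :
    (graph x y).Adj (right j ⟨t, by omega⟩ : DiamVertex m p q r) (right j ⟨t + 1, ht⟩) := by
  simp [graph, rel]

theorem left_mid' (i : Fin m) :
    (graph x y).Adj (left i 0 : DiamVertex m p q r) (mid' i) := by
  simp [graph, rel]

theorem right_mid (j : Fin m) :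
    (graph x y).Adj (right j 0 : DiamVertex m p q r) (mid j) := by
  simp [graph, rel]

theorem mid_mid' (i j : Fin m) :
    (graph x y).Adj (mid j : DiamVertex m p q r) (mid' i) := by
  simp [graph, rel]

theorem mid_spare (j : Fin m) (a : Fin r) :
    (graph x y).Adj (mid j : DiamVertex m p q r) (spare a) := by
  simp [graph, rel]

theorem left_spare (i : Fin m) (a : Fin r) :
    (graph x y).Adj (left i 0 : DiamVertex m p q r) (spare a) := by
  simp [graph, rel]

theorem left_left {i i' : Fin m} (h : i ≠ i') :
    (graph x y).Adj (left i 0 : DiamVertex m p q r) (left i' 0) := by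
  simp [graph, rel, h]

theorem right_right {j j' : Fin m} (h : j ≠ j') :
    (graph x y).Adj (right j 0 : DiamVertex m p q r) (right j' 0) := by
  simp [graph, rel, h]

/-- The vertex at which the tail of a vertex is attached. -/
def base : DiamVertex m p q r → DiamVertex m p q r
  | left i _ => left i 0
  | right j _ => right j 0
  | v => v

/-- The position of a vertex on its tail. -/
def height : DiamVertex m p q r → ℕ
  | left _ t => t
  | right _ t => t
  | _ => 0

theorem exists_walk_base (v : DiamVertex m p q r) :
    ∃ w : (graph x y).Walk v v.base, w.length ≤ v.height := by
  cases v with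
  | left i t =>
    obtain ⟨t, ht⟩ := t
    induction t with
    | zero => exact ⟨.nil, le_rfl⟩
    | succ t ih =>
      obtain ⟨w, hw⟩ := ih (by omega)
      exact ⟨.cons (left_tail i t ht).symm w, Nat.succ_le_succ hw⟩
  | right j t =>
    obtain ⟨t, ht⟩ := t
    induction t with
    | zero => exact ⟨.nil, le_rfl⟩
    | succ t ih =>
      obtain ⟨w, hw⟩ := ih (by omega)
      exact ⟨.cons (right_tail j t ht).symm w, Nat.succ_le_succ hw⟩
  | mid j => exact ⟨.nil, le_rfl⟩
  | mid' i => exact ⟨.nil, le_rfl⟩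
  | spare a => exact ⟨.nil, le_rfl⟩

theorem connected (hm : 0 < m) :
    (graph x y : SimpleGraph (DiamVertex m p q r)).Connected := by
  rw [SimpleGraph.connected_iff_exists_forall_reachable]
  refine ⟨mid ⟨0, hm⟩, fun v => ?_⟩
  obtain ⟨w, -⟩ := exists_walk_base (x := x) (y := y) v
  refine SimpleGraph.Reachable.trans ?_ w.reachable.symm
  cases v with
  | left i t => exact (mid_mid' i _).reachable.trans (left_mid' i).symm.reachable
  | right j t =>
    exact ((mid_mid' j _).reachable.trans (mid_mid' j j).symm.reachable).trans
      (right_mid j).symm.reachable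
  | mid j => exact (mid_mid' j _).reachable.trans (mid_mid' j j).symm.reachable
  | mid' i => exact (mid_mid' i _).reachable
  | spare a => exact (mid_spare _ a).reachable

/-- The kinds of vertices: left, right, and the others. -/
def kind : DiamVertex m p q r → Fin 3
  | left _ _ => 0
  | right _ _ => 1
  | _ => 2

theorem dist_base_le (hm : 0 < m) (hxy : ∀ i j, x i j = true ∨ y i j = false)
    (u v : DiamVertex m p q r) : (graph x y).dist u.base v.base ≤ 2 := by
  have hG : (graph x y : SimpleGraph (DiamVertex m p q r)).Connected := connected hm
  cases u <;> cases v
  case left.left i t i' t' =>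
    by_cases h : i = i'
    · simp [base, h]
    · exact (dist_le_one_of_adj (left_left h)).trans (by norm_num)
  case right.right i t i' t' =>
    by_cases h : i = i'
    · simp [base, h]
    · exact (dist_le_one_of_adj (right_right h)).trans (by norm_num)
  case left.right i t j t' =>
    rcases hxy i j with h | h
    · exact dist_le_two_of_adj hG (v := mid j) (by simp [base, graph, rel, h]) (right_mid j).symm
    · exact dist_le_two_of_adj hG (left_mid' i) (by simp [base, graph, rel, h])
  case right.left j t i t' =>
    rcases hxy i j with h | h
    · exact dist_le_two_of_adj hG (right_mid j) (by simp [base, graph, rel, h])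
    · exact dist_le_two_of_adj hG (v := mid' i) (by simp [base, graph, rel, h]) (left_mid' i).symm
  case left.mid i t j => exact dist_le_two_of_adj hG (left_mid' i) (mid_mid' _ _).symm
  case mid.left j i t => exact dist_le_two_of_adj hG (mid_mid' _ _) (left_mid' i).symm
  case right.mid' j t i => exact dist_le_two_of_adj hG (right_mid j) (mid_mid' _ _)
  case mid'.right i j t => exact dist_le_two_of_adj hG (mid_mid' _ _).symm (right_mid j).symm
  case left.mid' i t i' =>
    by_cases h : i = i'
    · subst h
      exact (dist_le_one_of_adj (left_mid' i)).trans (by norm_num)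
    · exact dist_le_two_of_adj hG (left_left h) (left_mid' i')
  case mid'.left i' i t =>
    by_cases h : i' = i
    · subst h
      exact (dist_le_one_of_adj (left_mid' i').symm).trans (by norm_num)
    · exact dist_le_two_of_adj hG (left_mid' i').symm (left_left h)
  case right.mid j t j' =>
    by_cases h : j = j'
    · subst h
      exact (dist_le_one_of_adj (right_mid j)).trans (by norm_num)
    · exact dist_le_two_of_adj hG (right_right h) (right_mid j')
  case mid.right j' j t =>
    by_cases h : j' = j
    · subst h
      exact (dist_le_one_of_adj (right_mid j').symm).trans (by norm_num)
    · exact dist_le_two_of_adj hG (right_mid j').symm (right_right h)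
  case mid.mid j j' => exact dist_le_two_of_adj hG (mid_mid' j _) (mid_mid' _ _).symm
  case mid'.mid' i i' => exact dist_le_two_of_adj hG (mid_mid' _ i).symm (mid_mid' _ _)
  case mid.mid' j i => exact (dist_le_one_of_adj (mid_mid' _ _)).trans (by norm_num)
  case mid'.mid i j => exact (dist_le_one_of_adj (mid_mid' _ _).symm).trans (by norm_num)
  case left.spare i t a => exact (dist_le_one_of_adj (left_spare _ _)).trans (by norm_num)
  case spare.left a i t => exact (dist_le_one_of_adj (left_spare _ _).symm).trans (by norm_num)
  case mid.spare j a => exact (dist_le_one_of_adj (mid_spare _ _)).trans (by norm_num)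
  case spare.mid a j => exact (dist_le_one_of_adj (mid_spare _ _).symm).trans (by norm_num)
  case mid'.spare i a => exact dist_le_two_of_adj hG (mid_mid' _ _).symm (mid_spare ⟨0, hm⟩ _)
  case spare.mid' a i => exact dist_le_two_of_adj hG (mid_spare ⟨0, hm⟩ _).symm (mid_mid' _ _)
  case right.spare j t a => exact dist_le_two_of_adj hG (right_mid _) (mid_spare _ _)
  case spare.right a j t => exact dist_le_two_of_adj hG (mid_spare _ _).symm (right_mid _).symm
  case spare.spare a a' =>
    exact dist_le_two_of_adj hG (mid_spare ⟨0, hm⟩ _).symm (mid_spare _ _)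

theorem dist_base_le_one_of_kind {u v : DiamVertex m p q r} (h : u.kind = v.kind)
    (h2 : u.kind ≠ 2) : (graph x y).dist u.base v.base ≤ 1 := by
  cases u <;> cases v <;> simp [kind] at h h2
  case left.left i t i' t' =>
    by_cases h : i = i'
    · simp [base, h]
    · exact dist_le_one_of_adj (left_left h)
  case right.right i t i' t' =>
    by_cases h : i = i'
    · simp [base, h]
    · exact dist_le_one_of_adj (right_right h)

/-- Both tails are walked down to their bases, which are at distance at most two. Two vertices of
the same side have bases at distance at most one, and `2 * p + 1 ≤ p + q + 2` is where nearly equal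
tails matter. -/
theorem dist_le (hm : 0 < m) (hqp : q ≤ p) (hpq : p ≤ q + 1)
    (hxy : ∀ i j, x i j = true ∨ y i j = false) (u v : DiamVertex m p q r) :
    (graph x y).dist u v ≤ p + q + 2 := by
  have hG : (graph x y : SimpleGraph (DiamVertex m p q r)).Connected := connected hm
  have tail (v : DiamVertex m p q r) : (graph x y).dist v v.base ≤ v.height := by
    obtain ⟨w, hw⟩ := exists_walk_base (x := x) (y := y) v
    exact (SimpleGraph.dist_le w).trans hw
  have h1 := tail u
  have h2 := tail v
  rw [SimpleGraph.dist_comm] at h2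
  have h3 := hG.dist_triangle (u := u) (v := u.base) (w := v)
  have h4 := hG.dist_triangle (u := u.base) (v := v.base) (w := v)
  have h5 := dist_base_le hm hxy u v
  have h6 := dist_base_le_one_of_kind (x := x) (y := y) (u := u) (v := v)
  have bound (v : DiamVertex m p q r) : v.height ≤ ![p, q, 0] v.kind := by
    cases v with
    | left i t => exact Nat.lt_succ_iff.1 t.2
    | right i t => exact Nat.lt_succ_iff.1 t.2
    | _ => simp [height]
  have h7 := bound u
  have h8 := bound v
  generalize u.kind = a at *
  generalize v.kind = b at *
  fin_cases a <;> fin_cases b <;> simp at h6 h7 h8 <;> omega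

/-- A function on the vertices, changing by at most one along each edge, that separates the ends
of the `i₀`-th left tail and the `j₀`-th right tail. -/
def potential (i₀ j₀ : Fin m) : DiamVertex m p q r → ℕ
  | left i t => if i = i₀ then p - t else p + 1
  | mid j => if j = j₀ then p + 2 else p + 1
  | mid' i => if i = i₀ then p + 1 else p + 2
  | right j t => if j = j₀ then p + 3 + t else p + 2
  | spare _ => p + 1

/-- The potential would jump by two only on the edges `left i₀`–`mid j₀` and `right j₀`–`mid' i₀`,
which the hypotheses remove. -/
theorem potential_rel {i₀ j₀ : Fin m} (hx : x i₀ j₀ = false) (hy : y i₀ j₀ = true)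
    {u v : DiamVertex m p q r} (h : rel x y u v) :
    potential i₀ j₀ u ≤ potential i₀ j₀ v + 1 ∧ potential i₀ j₀ v ≤ potential i₀ j₀ u + 1 := by
  cases u <;> cases v <;> simp only [rel] at h <;> simp only [potential] <;> split_ifs <;>
    first
    | omega
    | (exfalso; simp_all)

theorem rel_of_dist_le (hm : 0 < m)
    (h : ∀ u v : DiamVertex m p q r, (graph x y).dist u v ≤ p + q + 2) (i j : Fin m) :
    x i j = true ∨ y i j = false := by
  by_contra! hc
  have hx : x i j = false := by simpa using hc.1
  have hy : y i j = true := by simpa using hc.2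
  -- The potential is `0` at one of these ends and `p + q + 3` at the other.
  have h1 := h (left i (Fin.last p)) (right j (Fin.last q))
  have h2 := le_add_dist_of_adj (connected (x := x) (y := y) hm) (f := potential i j) ?_
    (left i (Fin.last p) : DiamVertex m p q r) (right j (Fin.last q))
  · simp [potential] at h2
    omega
  · intro u v huv
    rw [graph, SimpleGraph.fromRel_adj] at huv
    rcases huv.2 with h | h
    · exact (potential_rel hx hy h).2
    · exact (potential_rel hx hy h).1

/-- The first player owns the left tails. -/
def IsAlice : DiamVertex m p q r → Prop
  | left _ _ => True
  | mid _ => True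
  | spare _ => True
  | _ => False

end DiamVertex

theorem unlabelled_mem_diameterLang {n : ℕ} {V : Type*} (e : V ≃ Fin n) (G : SimpleGraph V)
    (hG : G.Connected) (D : ℕ) :
    unlabelled e G hG ∈ diameterLang D n ↔ ∀ u v, G.dist u v ≤ D := by
  have key : ∀ u v, (unlabelled e G hG).graph.dist (e u) (e v) = G.dist u v := by
    intro u v
    apply le_antisymm
    · obtain ⟨w, hw⟩ := hG.exists_walk_length_eq_dist u v
      rw [← hw, ← SimpleGraph.Walk.length_map (unlabelledIso e G hG).symm.toHom]
      exact SimpleGraph.dist_le _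
    · obtain ⟨w, hw⟩ := (unlabelled e G hG).connected.exists_walk_length_eq_dist (e u) (e v)
      rw [← hw, ← SimpleGraph.Walk.length_map (unlabelledIso e G hG).toHom]
      have h : ∀ u, (unlabelledIso e G hG).toHom (e u) = u := fun u => e.symm_apply_apply u
      calc G.dist u v = G.dist ((unlabelledIso e G hG).toHom (e u))
            ((unlabelledIso e G hG).toHom (e v)) := by rw [h, h]
        _ ≤ _ := SimpleGraph.dist_le _
  constructor
  · intro h u v
    rw [← key]
    exact h _ _
  · intro h u v
    rw [← e.apply_symm_apply u, ← e.apply_symm_apply v, key]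
    exact h _ _

theorem needsBandwidth_diameterLang (k c d D : ℕ) (hc : 1 ≤ c) (hD : 2 ≤ D) :
    NeedsBandwidth (1 / 3) k (polyNetworks c d) (diameterLang D) (fun n => Real.log n) := by
  apply needsBandwidth_log_of_sq_le (k / 2 + 1) (2 * (D + 2)) (by positivity) (by positivity)
  filter_upwards [eventually_ge_atTop (D + 2)] with n hn b V hV
  have hm : 0 < n / (D + 2) := Nat.div_pos hn (by omega)
  have hdiv := Nat.div_add_mod n (D + 2)
  have hmod := Nat.mod_lt n (show 0 < D + 2 by omega)
  refine ⟨n / (D + 2), ?_, ?_⟩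
  · nlinarith
  generalize n / (D + 2) = m at *
  -- The excess of `D` over `2` is split as evenly as possible between the tails.
  obtain ⟨p, q, rfl, hqp, hpq⟩ : ∃ p q, D = p + q + 2 ∧ q ≤ p ∧ p ≤ q + 1 :=
    ⟨D - 2 - (D - 2) / 2, (D - 2) / 2, by omega, by omega, by omega⟩
  generalize n % (p + q + 2 + 2) = r at *
  have hcard : Fintype.card (DiamVertex m p q r) = n := by
    rw [DiamVertex.card, ← hdiv]
    ring
  have : Nonempty (DiamVertex m p q r) := ⟨.mid ⟨0, hm⟩⟩
  have h := hV.card_le_of_graph_fooling hc (Fintype.equivFinOfCardEq hcard)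
    (ι := Fin m → Fin m → Bool) DiamVertex.graph DiamVertex.IsAlice
    (fun x y => DiamVertex.connected hm) ?_ ?_ ?_ ?_
  · simpa [← pow_mul] using h
  · intro x
    rw [unlabelled_mem_diameterLang]
    exact DiamVertex.dist_le hm hqp hpq fun i j => by cases x i j <;> simp
  · intro x y h1 h2
    rw [unlabelled_mem_diameterLang] at h1 h2
    funext i j
    have h1 := DiamVertex.rel_of_dist_le hm h1 i j
    have h2 := DiamVertex.rel_of_dist_le hm h2 i j
    revert h1 h2
    cases x i j <;> cases y i j <;> simp
  · intro x y y' v u hv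
    cases v <;> cases u <;>
      simp_all [DiamVertex.IsAlice, DiamVertex.graph, DiamVertex.rel]
  · intro x x' y v u hv
    cases v <;> cases u <;>
      simp_all [DiamVertex.IsAlice, DiamVertex.graph, DiamVertex.rel]

/-! ### Non-3-colourability -/

/-- Vertices of the colouring construction. The palette is `0` (selected), `1` and `2` (not
selected, for rows and columns); the literals of the rows (`false`) and columns (`true`), their
negations and copies; the odd cycles that enforce a selection; and spare vertices. -/
inductive ColVertex (m r : ℕ)
  | palette (a : Fin 3)
  | lit (σ : Bool) (i : Fin m)
  | neg (σ : Bool) (i : Fin m)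
  | copy (σ : Bool) (i : Fin m)
  | cyc (σ : Bool) (i : Fin m)
  | spare (a : Fin r)
  deriving DecidableEq, Fintype

namespace ColVertex

variable {m r : ℕ}

theorem card : Fintype.card (ColVertex m r) = 8 * m + 3 + r := by
  rw [← Fintype.card_congr (proxy_equiv% (ColVertex m r))]
  simp
  ring

/-- The colour of a row or column that is not selected. -/
def idle (σ : Bool) : Fin 3 := if σ then 2 else 1

/-- The colour that a row or column cannot have. -/
def forbidden (σ : Bool) : Fin 3 := if σ then 1 else 2

/-- The edges of the colouring construction, each in one direction. -/
def rel (x y : Fin m → Fin m → Bool) : ColVertex m r → ColVertex m r → Prop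
  | palette _, palette _ => True
  | palette a, spare _ => a = 0
  | palette a, lit σ _ => a = forbidden σ
  | palette a, neg σ _ => a = forbidden σ
  | palette a, copy σ _ => a = forbidden σ
  | lit σ i, neg τ j => σ = τ ∧ i = j
  | neg σ i, copy τ j => σ = τ ∧ i = j
  | cyc σ i, lit τ j => σ = τ ∧ i = j
  | cyc σ i, cyc τ j => σ = τ ∧ (SimpleGraph.cycleGraph m).Adj i j
  | lit σ i, lit τ j => σ = false ∧ τ = true ∧ x i j = true
  -- Using copies here keeps the edges of `y` away from the vertices that carry the edges of `x`.
  | copy σ i, copy τ j => σ = false ∧ τ = true ∧ y i j = false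
  | _, _ => False

/-- The graph of the colouring construction. -/
def graph (x y : Fin m → Fin m → Bool) : SimpleGraph (ColVertex m r) :=
  SimpleGraph.fromRel (rel x y)

variable {x y : Fin m → Fin m → Bool}

theorem palette_palette {a b : Fin 3} (h : a ≠ b) :
    (graph x y).Adj (palette a : ColVertex m r) (palette b) := by simp [graph, rel, h]

theorem palette_spare (a : Fin r) :
    (graph x y).Adj (palette 0 : ColVertex m r) (spare a) := by simp [graph, rel]

theorem palette_lit (σ : Bool) (i : Fin m) :
    (graph x y).Adj (palette (forbidden σ) : ColVertex m r) (lit σ i) := by simp [graph, rel]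

theorem palette_neg (σ : Bool) (i : Fin m) :
    (graph x y).Adj (palette (forbidden σ) : ColVertex m r) (neg σ i) := by simp [graph, rel]

theorem palette_copy (σ : Bool) (i : Fin m) :
    (graph x y).Adj (palette (forbidden σ) : ColVertex m r) (copy σ i) := by simp [graph, rel]

theorem lit_neg (σ : Bool) (i : Fin m) :
    (graph x y).Adj (lit σ i : ColVertex m r) (neg σ i) := by simp [graph, rel]

theorem neg_copy (σ : Bool) (i : Fin m) :
    (graph x y).Adj (neg σ i : ColVertex m r) (copy σ i) := by simp [graph, rel]

theorem cyc_lit (σ : Bool) (i : Fin m) :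
    (graph x y).Adj (cyc σ i : ColVertex m r) (lit σ i) := by simp [graph, rel]

theorem cyc_cyc (σ : Bool) {i j : Fin m} (h : (SimpleGraph.cycleGraph m).Adj i j) :
    (graph x y).Adj (cyc σ i : ColVertex m r) (cyc σ j) := by simp [graph, rel, h, h.ne]

theorem connected : (graph x y : SimpleGraph (ColVertex m r)).Connected := by
  rw [SimpleGraph.connected_iff_exists_forall_reachable]
  refine ⟨palette 0, fun v => ?_⟩
  have hp : ∀ a, (graph x y).Reachable (palette 0 : ColVertex m r) (palette a) := by
    intro a
    by_cases h : 0 = a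
    · rw [h]
    · exact (palette_palette h).reachable
  cases v with
  | palette a => exact hp a
  | lit σ i => exact (hp _).trans (palette_lit σ i).reachable
  | neg σ i => exact (hp _).trans (palette_neg σ i).reachable
  | copy σ i => exact (hp _).trans (palette_copy σ i).reachable
  | cyc σ i => exact ((hp _).trans (palette_lit σ i).reachable).trans (cyc_lit σ i).symm.reachable
  | spare a => exact (palette_spare a).reachable

theorem fin_three_eq {σ : Bool} {a : Fin 3} (h0 : a ≠ 0) (h1 : a ≠ forbidden σ) : a = idle σ := by
  revert a; cases σ <;> decide

theorem fin_three_eq_zero {σ : Bool} {a : Fin 3} (h0 : a ≠ idle σ) (h1 : a ≠ forbidden σ) :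
    a = 0 := by
  revert a; cases σ <;> decide

/-- The odd cycles force a row `i` and a column `j` to have colour `0`, and the negations pass this
on to the copies. One of the two possible edges at `(i, j)` is present and joins two vertices of
colour `0`. -/
theorem not_colorable (hm : 2 ≤ m) (hodd : Odd m) (hxy : ∀ i j, x i j = true ∨ y i j = false) :
    ¬ (graph x y : SimpleGraph (ColVertex m r)).Colorable 3 := by
  rintro ⟨C₀⟩
  -- The palette is a triangle, so the colours can be renamed to agree with it.
  obtain ⟨C, hC, hpal⟩ : ∃ C : ColVertex m r → Fin 3,
      (∀ u v, (graph x y).Adj u v → C u ≠ C v) ∧ ∀ a, C (palette a) = a := by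
    have hinj : Function.Injective fun a : Fin 3 => C₀ (palette a) := by
      intro a b hab
      by_contra h
      exact C₀.valid (palette_palette h) hab
    have hbij := Finite.injective_iff_bijective.1 hinj
    refine ⟨fun v => (Equiv.ofBijective _ hbij).symm (C₀ v), fun u v huv h => ?_, fun a => ?_⟩
    · exact C₀.valid huv ((Equiv.ofBijective _ hbij).symm.injective h)
    · exact (Equiv.ofBijective _ hbij).symm_apply_apply a
  have hlit : ∀ σ i, C (lit σ i) ≠ forbidden σ := fun σ i => by
    have := hC _ _ (palette_lit σ i)
    rw [hpal] at this
    exact this.symm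
  have hneg : ∀ σ i, C (neg σ i) ≠ forbidden σ := fun σ i => by
    have := hC _ _ (palette_neg σ i)
    rw [hpal] at this
    exact this.symm
  have hcopy : ∀ σ i, C (copy σ i) ≠ forbidden σ := fun σ i => by
    have := hC _ _ (palette_copy σ i)
    rw [hpal] at this
    exact this.symm
  have hsel : ∀ σ, ∃ i, C (lit σ i) = 0 := by
    intro σ
    by_contra! h
    -- If nothing is selected, every literal is idle and the odd cycle would be coloured with the
    -- other two colours.
    have hcyc : ∀ i, C (cyc σ i) ≠ idle σ := fun i => by
      rw [← fin_three_eq (h i) (hlit σ i)]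
      exact hC _ _ (cyc_lit σ i)
    let D : (SimpleGraph.cycleGraph m).Coloring {a : Fin 3 // a ≠ idle σ} :=
      SimpleGraph.Coloring.mk (fun i => ⟨C (cyc σ i), hcyc i⟩) fun {i j} hij h => by
        rw [Subtype.mk.injEq] at h
        exact hC _ _ (cyc_cyc σ hij) h
    have h2 := D.colorable.chromaticNumber_le
    rw [SimpleGraph.chromaticNumber_cycleGraph_of_odd m hm hodd] at h2
    revert h2
    have h23 : ¬ ((3 : ℕ) : ℕ∞) ≤ ((2 : ℕ) : ℕ∞) := by
      rw [Nat.cast_le]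
      norm_num
    cases σ <;> simpa [idle, Fintype.card_subtype_compl] using h23
  have hsel' : ∀ σ i, C (lit σ i) = 0 → C (copy σ i) = 0 := by
    intro σ i h
    have h1 := hC _ _ (lit_neg σ i)
    rw [h] at h1
    have h2 := fin_three_eq h1.symm (hneg σ i)
    have h3 := hC _ _ (neg_copy σ i)
    rw [h2] at h3
    exact fin_three_eq_zero h3.symm (hcopy σ i)
  obtain ⟨i, hi⟩ := hsel false
  obtain ⟨j, hj⟩ := hsel true
  rcases hxy i j with h | h
  · exact hC (lit false i) (lit true j) (by simp [graph, rel, h]) (hi.trans hj.symm)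
  · exact hC (copy false i) (copy true j) (by simp [graph, rel, h])
      ((hsel' _ _ hi).trans (hsel' _ _ hj).symm)

/-- The colour of a vertex of an odd cycle at distance `a` from the selected one. -/
def cycColor (σ : Bool) (a : ℕ) : Fin 3 :=
  if a = 0 then idle σ else if a % 2 = 1 then 0 else forbidden σ

/-- The colouring that selects the rows and columns `s`. -/
def color (s : Bool → Fin m) : ColVertex m r → Fin 3
  | palette a => a
  | lit σ i => if i = s σ then 0 else idle σ
  | neg σ i => if i = s σ then idle σ else 0
  | copy σ i => if i = s σ then 0 else idle σ
  | cyc σ i => cycColor σ (i - s σ : Fin m)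
  | spare _ => 1

theorem idle_ne_zero (σ : Bool) : idle σ ≠ 0 := by cases σ <;> decide

theorem forbidden_ne_zero (σ : Bool) : forbidden σ ≠ 0 := by cases σ <;> decide

theorem idle_ne_forbidden (σ : Bool) : idle σ ≠ forbidden σ := by cases σ <;> decide

/-- The cycle is odd, so its last position `2 * h + 2` is even and nonzero: it has the forbidden
colour and closes up against the idle colour at `0`. -/
theorem cycColor_ne {h : ℕ} (σ : Bool) (a b : Fin (2 * h + 3)) (hab : a = b + 1) :
    cycColor σ a ≠ cycColor σ b := by
  have h1 := idle_ne_zero σ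
  have h2 := forbidden_ne_zero σ
  have h3 := idle_ne_forbidden σ
  have hval : (a : ℕ) = b + 1 ∨ ((a : ℕ) = 0 ∧ (b : ℕ) = 2 * h + 2) := by
    rw [hab, Fin.val_add_one]
    split_ifs with hb
    · exact .inr ⟨rfl, by rw [hb, Fin.val_last]⟩
    · exact .inl rfl
  unfold cycColor
  split_ifs <;>
    first
    | exact h1 | exact h1.symm | exact h2 | exact h2.symm | exact h3 | exact h3.symm | omega

/-- Select only row `i` and column `j`. Idle rows and idle columns have different colours, so a
cross edge can fail only at `(i, j)`, where both edges are absent. -/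
theorem colorable {h : ℕ} {x y : Fin (2 * h + 3) → Fin (2 * h + 3) → Bool}
    {i j : Fin (2 * h + 3)} (hx : x i j = false) (hy : y i j = true) :
    (graph x y : SimpleGraph (ColVertex (2 * h + 3) r)).Colorable 3 := by
  let s : Bool → Fin (2 * h + 3) := fun σ => if σ then j else i
  suffices hC : ∀ u v : ColVertex (2 * h + 3) r, u ≠ v → rel x y u v → color s u ≠ color s v by
    refine ⟨SimpleGraph.Coloring.mk (color s) fun {u v} huv => ?_⟩
    rw [graph, SimpleGraph.fromRel_adj] at huv
    rcases huv.2 with h | h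
    · exact hC _ _ huv.1 h
    · exact (hC _ _ huv.1.symm h).symm
  have h1 := idle_ne_zero
  have h2 := forbidden_ne_zero
  have h3 := idle_ne_forbidden
  intro u v huv hrel
  cases u <;> cases v <;> simp only [rel] at hrel
  case palette.palette a b => simpa [color] using huv
  case palette.spare a b => simp [color, hrel]
  case palette.lit a σ i =>
    simp only [color, hrel]
    split_ifs
    exacts [h2 σ, (h3 σ).symm]
  case palette.neg a σ i =>
    simp only [color, hrel]
    split_ifs
    exacts [(h3 σ).symm, h2 σ]
  case palette.copy a σ i =>
    simp only [color, hrel]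
    split_ifs
    exacts [h2 σ, (h3 σ).symm]
  case lit.neg σ i τ j =>
    obtain ⟨rfl, rfl⟩ := hrel
    simp only [color]
    split_ifs
    exacts [(h1 σ).symm, h1 σ]
  case neg.copy σ i τ j =>
    obtain ⟨rfl, rfl⟩ := hrel
    simp only [color]
    split_ifs
    exacts [h1 σ, (h1 σ).symm]
  case cyc.lit σ i τ j =>
    obtain ⟨rfl, rfl⟩ := hrel
    simp only [color, cycColor, Fin.val_eq_zero_iff, sub_eq_zero]
    split_ifs
    exacts [h1 σ, (h1 σ).symm, (h3 σ).symm]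
  case cyc.cyc σ i τ j =>
    obtain ⟨rfl, hij⟩ := hrel
    rw [SimpleGraph.cycleGraph_adj] at hij
    simp only [color]
    rcases hij with hij | hij
    · exact cycColor_ne σ _ _ (by rw [← hij]; abel)
    · exact (cycColor_ne σ _ _ (by rw [← hij]; abel)).symm
  case lit.lit σ i' τ j' =>
    obtain ⟨rfl, rfl, hij⟩ := hrel
    simp only [color, s]
    split_ifs <;> simp_all [idle]
  case copy.copy σ i' τ j' =>
    obtain ⟨rfl, rfl, hij⟩ := hrel
    simp only [color, s]
    split_ifs <;> simp_all [idle]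

/-- The second player owns the copies. -/
def IsAlice : ColVertex m r → Prop
  | copy _ _ => False
  | _ => True

end ColVertex

theorem unlabelled_mem_nonThreeColLang {n : ℕ} {V : Type*} (e : V ≃ Fin n) (G : SimpleGraph V)
    (hG : G.Connected) : unlabelled e G hG ∈ nonThreeColLang n ↔ ¬ G.Colorable 3 :=
  not_congr ⟨fun h => h.of_hom (unlabelledIso e G hG).symm.toHom,
    fun h => h.of_hom (unlabelledIso e G hG).toHom⟩

theorem needsBandwidth_nonThreeColLang (k c d : ℕ) (hc : 1 ≤ c) :
    NeedsBandwidth (1 / 3) k (polyNetworks c d) nonThreeColLang (fun n => Real.log n) := by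
  apply needsBandwidth_log_of_sq_le (k / 2 + 1) 16 (by positivity) (by positivity)
  filter_upwards [eventually_ge_atTop 27] with n hn b V hV
  -- The parameter `m = 2 * h + 3` must be odd, so the sizes advance in steps of 16, filled by spare
  -- vertices.
  obtain ⟨h, r, hr, hhr⟩ : ∃ h r, r < 16 ∧ n = 8 * (2 * h + 3) + 3 + r :=
    ⟨(n - 27) / 16, (n - 27) % 16, Nat.mod_lt _ (by norm_num), by omega⟩
  refine ⟨2 * h + 3, by omega, ?_⟩
  have : Nonempty (ColVertex (2 * h + 3) r) := ⟨.palette 0⟩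
  have h := hV.card_le_of_graph_fooling hc
    (Fintype.equivFinOfCardEq (ColVertex.card.trans hhr.symm))
    (ι := Fin (2 * h + 3) → Fin (2 * h + 3) → Bool) ColVertex.graph ColVertex.IsAlice
    (fun x y => ColVertex.connected) ?_ ?_ ?_ ?_
  · simpa [← pow_mul] using h
  · intro x
    rw [unlabelled_mem_nonThreeColLang]
    exact ColVertex.not_colorable (by omega) ⟨h + 1, by ring⟩
      fun i j => by cases x i j <;> simp
  · intro x y h1 h2
    rw [unlabelled_mem_nonThreeColLang] at h1 h2
    funext i j
    by_contra hne
    cases hx : x i j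
    · exact h1 (ColVertex.colorable hx (by simpa [hx] using hne))
    · exact h2 (ColVertex.colorable (by simpa [hx] using hne) hx)
  · intro x y y' v u hv
    cases v <;> cases u <;>
      simp_all [ColVertex.IsAlice, ColVertex.graph, ColVertex.rel]
  · intro x x' y v u hv
    cases v <;> cases u <;>
      simp_all [ColVertex.IsAlice, ColVertex.graph, ColVertex.rel]

/-! ### Symmetry -/

/-- Vertices of the symmetry construction: a ruler, two copies of an indexed set of nodes, and a
hub for each copy. -/
inductive SymVertex (h M : ℕ)
  | ruler (i : Fin (M + 1))
  | node (σ : Bool) (γ : Option (Fin h ⊕ Fin h))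
  | hub (σ : Bool)
  deriving DecidableEq, Fintype

namespace SymVertex

variable {h M : ℕ}

theorem card : Fintype.card (SymVertex h M) = M + 4 * h + 5 := by
  rw [← Fintype.card_congr (proxy_equiv% (SymVertex h M))]
  simp
  ring

/-- The point of the ruler at which a node is attached. -/
def pos : Option (Fin h ⊕ Fin h) → ℕ
  | none => 0
  | some (.inl i) => 1 + i
  | some (.inr j) => 1 + h + j

theorem pos_le (γ : Option (Fin h ⊕ Fin h)) : pos γ ≤ 2 * h := by
  rcases γ with _ | i | j <;> simp only [pos] <;> omega

theorem pos_injective : Function.Injective (pos : Option (Fin h ⊕ Fin h) → ℕ) := by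
  rintro (_ | i | j) (_ | i' | j') hij <;> simp only [pos] at hij <;>
    first
    | rfl
    | omega
    | (congr; omega)

/-- The edges inside one copy. -/
def inner (z : Fin h → Fin h → Bool) : Option (Fin h ⊕ Fin h) → Option (Fin h ⊕ Fin h) → Prop
  | none, some _ => True
  | some (.inl i), some (.inr j) => z i j = true
  | _, _ => False

/-- The edges of the symmetry construction, each in one direction. -/
def rel (x y : Fin h → Fin h → Bool) : SymVertex h M → SymVertex h M → Prop
  | ruler i, ruler j => (i : ℕ) + 1 = j
  | ruler i, node _ γ => (i : ℕ) = pos γ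
  | node σ γ, node τ δ => σ = τ ∧ inner (if σ then y else x) γ δ
  | hub σ, node τ _ => σ = τ
  | _, _ => False

/-- The graph of the symmetry construction. -/
def graph (x y : Fin h → Fin h → Bool) : SimpleGraph (SymVertex h M) :=
  SimpleGraph.fromRel (rel x y)

variable {x y : Fin h → Fin h → Bool}

theorem ruler_ruler {i j : Fin (M + 1)} :
    (graph x y).Adj (ruler i : SymVertex h M) (ruler j) ↔ (i : ℕ) + 1 = j ∨ (j : ℕ) + 1 = i := by
  simp only [graph, SimpleGraph.fromRel_adj, rel, ne_eq, ruler.injEq, Fin.ext_iff]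
  omega

theorem ruler_node {i : Fin (M + 1)} {σ : Bool} {γ : Option (Fin h ⊕ Fin h)} :
    (graph x y).Adj (ruler i : SymVertex h M) (node σ γ) ↔ (i : ℕ) = pos γ := by
  simp [graph, rel]

theorem not_ruler_hub {i : Fin (M + 1)} {σ : Bool} :
    ¬ (graph x y).Adj (ruler i : SymVertex h M) (hub σ) := by
  simp [graph, rel]

theorem hub_node {σ τ : Bool} {γ : Option (Fin h ⊕ Fin h)} :
    (graph x y).Adj (hub σ : SymVertex h M) (node τ γ) ↔ σ = τ := by
  simp [graph, rel]

theorem node_node {σ τ : Bool} {γ δ : Option (Fin h ⊕ Fin h)} :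
    (graph x y).Adj (node σ γ : SymVertex h M) (node τ δ) ↔
      σ = τ ∧ (inner (if σ then y else x) γ δ ∨ inner (if σ then y else x) δ γ) := by
  have hirr : ∀ z : Fin h → Fin h → Bool, ¬ inner z γ γ := by
    intro z
    rcases γ with _ | i | j <;> simp [inner]
  simp only [graph, SimpleGraph.fromRel_adj, rel, ne_eq, node.injEq]
  constructor
  · rintro ⟨-, ⟨rfl, h⟩ | ⟨rfl, h⟩⟩
    exacts [⟨rfl, .inl h⟩, ⟨rfl, .inr h⟩]
  · rintro ⟨rfl, hi⟩
    refine ⟨?_, by tauto⟩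
    rintro ⟨-, rfl⟩
    exact hi.elim (hirr _) (hirr _)

theorem none_some (σ : Bool) (a : Fin h ⊕ Fin h) :
    (graph x y).Adj (node σ none : SymVertex h M) (node σ (some a)) := by
  simp [node_node, inner]

theorem connected (hM : 2 * h < M) : (graph x y : SimpleGraph (SymVertex h M)).Connected := by
  rw [SimpleGraph.connected_iff_exists_forall_reachable]
  refine ⟨ruler 0, fun v => ?_⟩
  have hr : ∀ i : ℕ, (hi : i < M + 1) →
      (graph x y).Reachable (ruler 0 : SymVertex h M) (ruler ⟨i, hi⟩) := by
    intro i
    induction i with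
    | zero => exact fun _ => .rfl
    | succ i ih =>
      intro hi
      refine (ih (by omega)).trans (SimpleGraph.Adj.reachable ?_)
      simp [ruler_ruler]
  have hn : ∀ σ γ, (graph x y).Reachable (ruler 0 : SymVertex h M) (node σ γ) := by
    intro σ γ
    have := pos_le γ
    exact (hr (pos γ) (by omega)).trans (SimpleGraph.Adj.reachable (ruler_node.2 rfl))
  cases v with
  | ruler i => exact hr i i.2
  | node σ γ => exact hn σ γ
  | hub σ => exact (hn σ none).trans (hub_node.2 rfl).symm.reachable

/-- The exchange of the two copies. -/
def flip : SymVertex h M → SymVertex h M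
  | ruler i => ruler i
  | node σ γ => node (!σ) γ
  | hub σ => hub (!σ)

theorem flip_involutive : Function.Involutive (flip : SymVertex h M → SymVertex h M) := by
  rintro (_ | _ | _) <;> simp [flip]

/-- The automorphisms of the symmetry construction. -/
abbrev Aut (M : ℕ) (x y : Fin h → Fin h → Bool) :=
  (graph x y : SimpleGraph (SymVertex h M)) ≃g (graph x y : SimpleGraph (SymVertex h M))

/-- The exchange of two equal copies is an automorphism. -/
def flipIso (x : Fin h → Fin h → Bool) : Aut M x x where
  toEquiv := flip_involutive.toPerm
  map_rel_iff' {u v} := by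
    rw [Function.Involutive.coe_toPerm]
    cases u <;> cases v <;> simp [flip, graph, rel]

/-- Membership in a triangle. -/
def InTriangle {V : Type*} (G : SimpleGraph V) (v : V) : Prop :=
  ∃ u w, G.Adj v u ∧ G.Adj u w ∧ G.Adj w v

theorem InTriangle.map {V : Type*} {G : SimpleGraph V} (φ : G ≃g G) {v : V}
    (hv : InTriangle G v) : InTriangle G (φ v) := by
  obtain ⟨u, w, h1, h2, h3⟩ := hv
  exact ⟨φ u, φ w, φ.map_adj_iff.2 h1, φ.map_adj_iff.2 h2, φ.map_adj_iff.2 h3⟩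

/-- A node meets the ruler at one point only, and distinct nodes attached at the same point lie in
different copies, hence are not adjacent. Since all other vertices do lie in triangles,
automorphisms preserve the ruler. -/
theorem not_inTriangle_ruler (i : Fin (M + 1)) :
    ¬ InTriangle (graph x y) (ruler i : SymVertex h M) := by
  rintro ⟨u, w, h1, h2, h3⟩
  cases u <;> cases w <;>
    first
    | exact not_ruler_hub h1
    | exact not_ruler_hub h3.symm
    | skip
  case ruler.ruler j k =>
    rw [ruler_ruler] at h1 h2 h3
    omega
  case ruler.node j σ γ =>
    rw [ruler_ruler] at h1
    rw [ruler_node] at h2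
    rw [SimpleGraph.adj_comm, ruler_node] at h3
    omega
  case node.ruler σ γ j =>
    rw [ruler_node] at h1
    rw [SimpleGraph.adj_comm, ruler_node] at h2
    rw [ruler_ruler] at h3
    omega
  case node.node σ γ τ δ =>
    rw [ruler_node] at h1
    rw [SimpleGraph.adj_comm, ruler_node] at h3
    have := pos_injective (h1.symm.trans h3)
    subst this
    obtain ⟨rfl, -⟩ := node_node.1 h2
    exact h2.ne rfl

theorem inTriangle_hub (hh : 0 < h) (σ : Bool) :
    InTriangle (graph x y) (hub σ : SymVertex h M) :=
  ⟨node σ none, node σ (some (.inl ⟨0, hh⟩)), hub_node.2 rfl, none_some _ _,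
    (hub_node.2 rfl).symm⟩

theorem inTriangle_node (hh : 0 < h) (σ : Bool) (γ : Option (Fin h ⊕ Fin h)) :
    InTriangle (graph x y) (node σ γ : SymVertex h M) := by
  cases γ with
  | none =>
    exact ⟨node σ (some (.inl ⟨0, hh⟩)), hub σ, none_some _ _, (hub_node.2 rfl).symm,
      hub_node.2 rfl⟩
  | some a =>
    exact ⟨node σ none, hub σ, (none_some _ _).symm, (hub_node.2 rfl).symm, hub_node.2 rfl⟩

theorem exists_map_ruler (hh : 0 < h) (φ : Aut M x y)
    (i : Fin (M + 1)) : ∃ j, φ (ruler i) = ruler j := by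
  have hn : ¬ InTriangle (graph x y) (φ (ruler i)) := by
    intro ht
    have := ht.map φ.symm
    rw [RelIso.symm_apply_apply] at this
    exact not_inTriangle_ruler i this
  cases hv : φ (ruler i) with
  | ruler j => exact ⟨j, rfl⟩
  | node σ γ => exact absurd (hv ▸ inTriangle_node hh σ γ) hn
  | hub σ => exact absurd (hv ▸ inTriangle_hub hh σ) hn

/-- The far end lies beyond all attachment points and is the only ruler vertex with a single
neighbour. -/
theorem map_ruler_last (hh : 0 < h) (hM : 2 * h < M)
    (φ : Aut M x y) :
    φ (ruler (Fin.last M)) = ruler (Fin.last M) := by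
  have leaf : ∀ u w, (graph x y).Adj (ruler (Fin.last M) : SymVertex h M) u →
      (graph x y).Adj (ruler (Fin.last M)) w → u = w := by
    have aux : ∀ u, (graph x y).Adj (ruler (Fin.last M) : SymVertex h M) u →
        u = ruler ⟨M - 1, by omega⟩ := by
      intro u hu
      cases u with
      | ruler j =>
        rw [ruler_ruler, Fin.val_last] at hu
        refine congrArg ruler (Fin.ext ?_)
        dsimp only
        omega
      | node σ γ =>
        rw [ruler_node, Fin.val_last] at hu
        have := pos_le γ
        omega
      | hub σ => exact absurd hu not_ruler_hub
    intro u w hu hw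
    rw [aux u hu, aux w hw]
  obtain ⟨j, hj⟩ := exists_map_ruler hh φ (Fin.last M)
  have leaf' : ∀ u w, (graph x y).Adj (ruler j : SymVertex h M) u →
      (graph x y).Adj (ruler j) w → u = w := by
    intro u w hu hw
    rw [← hj] at hu hw
    have h1 := φ.symm.map_adj_iff.2 hu
    have h2 := φ.symm.map_adj_iff.2 hw
    rw [RelIso.symm_apply_apply] at h1 h2
    exact φ.symm.injective (leaf _ _ h1 h2)
  rw [hj]
  by_contra hne
  have hlt : (j : ℕ) < M := by
    have : (j : ℕ) ≠ M := fun hjM => hne (congrArg ruler (Fin.ext hjM))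
    omega
  rcases Nat.eq_zero_or_pos j with h0 | h0
  · have := leaf' (ruler ⟨j + 1, by omega⟩) (node false none) (ruler_ruler.2 (.inl rfl))
      (ruler_node.2 h0)
    simp at this
  · have := leaf' (ruler ⟨j + 1, by omega⟩) (ruler ⟨j - 1, by omega⟩) (ruler_ruler.2 (.inl rfl))
      (ruler_ruler.2 (.inr (Nat.sub_add_cancel h0)))
    simp at this
    omega

theorem map_ruler (hh : 0 < h) (hM : 2 * h < M)
    (φ : Aut M x y) (i : Fin (M + 1)) :
    φ (ruler i) = ruler i := by
  suffices H : ∀ d : ℕ, ∀ i : Fin (M + 1), (i : ℕ) + d = M → φ (ruler i) = ruler i from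
    H (M - i) i (by omega)
  intro d
  induction d using Nat.strong_induction_on with
  | _ d ih =>
    intro i hi
    rcases Nat.eq_zero_or_pos d with rfl | hd
    · have : i = Fin.last M := Fin.ext hi
      rw [this]
      exact map_ruler_last hh hM φ
    · obtain ⟨j, hj⟩ := exists_map_ruler hh φ i
      have h1 : φ (ruler ⟨i + 1, by omega⟩) = ruler ⟨i + 1, by omega⟩ :=
        ih (d - 1) (by omega) _ (by dsimp only; omega)
      have h2 : (graph x y).Adj (φ (ruler i)) (φ (ruler ⟨i + 1, by omega⟩)) :=
        φ.map_adj_iff.2 (ruler_ruler.2 (.inl rfl))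
      rw [hj, h1, ruler_ruler] at h2
      rw [hj]
      rcases h2 with h2 | h2
      · congr
        exact Fin.ext (by simpa using h2)
      -- The only other candidate for the image is the point two steps up, which is already fixed.
      · have h3 : φ (ruler j) = ruler j := ih (d - 2) (by
          have := j.2
          dsimp only at h2
          omega) _ (by
          have := j.2
          dsimp only at h2
          omega)
        have h4 := φ.injective (hj.trans h3.symm)
        rw [ruler.injEq] at h4
        rw [h4]

/-- The fixed ruler identifies a node, up to its copy, by its point of attachment. -/
theorem exists_map_node (hh : 0 < h) (hM : 2 * h < M)
    (φ : Aut M x y) (σ : Bool)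
    (γ : Option (Fin h ⊕ Fin h)) : ∃ τ, φ (node σ γ) = node τ γ := by
  have hpos := pos_le γ
  have h1 : (graph x y).Adj (φ (ruler ⟨pos γ, by omega⟩)) (φ (node σ γ)) :=
    φ.map_adj_iff.2 (ruler_node.2 rfl)
  have h2 := (inTriangle_node (x := x) (y := y) (M := M) hh σ γ).map φ
  rw [map_ruler hh hM] at h1
  cases hv : φ (node σ γ) with
  | ruler j => exact absurd (hv ▸ h2) (not_inTriangle_ruler j)
  | node τ δ =>
    rw [hv, ruler_node] at h1
    exact ⟨τ, by rw [pos_injective h1]⟩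
  | hub τ => exact absurd (hv ▸ h1) not_ruler_hub

theorem exists_map_hub (hh : 0 < h) (hM : 2 * h < M)
    (φ : Aut M x y) (σ : Bool) :
    ∃ τ, φ (hub σ) = hub τ := by
  have h2 := (inTriangle_hub (x := x) (y := y) (M := M) hh σ).map φ
  cases hv : φ (hub σ) with
  | ruler j => exact absurd (hv ▸ h2) (not_inTriangle_ruler j)
  | node τ δ =>
    have hpos := pos_le δ
    have h1 : (graph x y).Adj (φ (ruler ⟨pos δ, by omega⟩)) (φ (hub σ)) := by
      rw [map_ruler hh hM, hv]
      exact ruler_node.2 rfl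
    exact absurd (φ.map_adj_iff.1 h1) not_ruler_hub
  | hub τ => exact ⟨τ, rfl⟩

/-- The hubs make each copy move as a whole. A non-trivial automorphism therefore exchanges the
copies while keeping indices, and so matches the edges of `x` with those of `y`. -/
theorem eq_of_automorphism (hh : 0 < h) (hM : 2 * h < M)
    (φ : Aut M x y) (hφ : ∃ v, φ v ≠ v) :
    x = y := by
  choose f hf using exists_map_node hh hM φ
  choose g hg using exists_map_hub hh hM φ
  have hfg : ∀ σ γ, f σ γ = g σ := by
    intro σ γ
    have h1 : (graph x y).Adj (φ (hub σ)) (φ (node σ γ)) := φ.map_adj_iff.2 (hub_node.2 rfl)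
    rw [hf, hg, hub_node] at h1
    exact h1.symm
  have hinj : g true ≠ g false := by
    intro heq
    have := φ.injective ((hg true).trans ((congrArg hub heq).trans (hg false).symm))
    simp at this
  cases h0 : g false with
  | false =>
    have h1 : ∀ σ, g σ = σ := by
      rintro (_ | _)
      · exact h0
      · simpa [h0] using hinj
    obtain ⟨v, hv⟩ := hφ
    exfalso
    apply hv
    cases v with
    | ruler i => exact map_ruler hh hM φ i
    | node σ γ => rw [hf, hfg, h1]
    | hub σ => rw [hg, h1]
  | true =>
    funext i j
    have h1 := φ.map_adj_iff (v := node false (some (.inl i))) (w := node false (some (.inr j)))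
    rw [hf, hf, hfg, hfg, h0, node_node, node_node] at h1
    simp only [inner, or_false, true_and, if_true] at h1
    exact Bool.eq_iff_iff.2 h1.symm

/-- The first player owns the ruler and the copy `false`. -/
def IsAlice : SymVertex h M → Prop
  | ruler _ => True
  | node σ _ => σ = false
  | hub σ => σ = false

end SymVertex

theorem unlabelled_mem_symmetryLang {n : ℕ} {V : Type*} (e : V ≃ Fin n) (G : SimpleGraph V)
    (hG : G.Connected) :
    unlabelled e G hG ∈ symmetryLang n ↔ ∃ φ : G ≃g G, ∃ v, φ v ≠ v := by
  let ψ := unlabelledIso e G hG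
  constructor
  · rintro ⟨φ, v, hv⟩
    refine ⟨ψ.symm.trans (φ.trans ψ), ψ v, fun h => hv (ψ.injective ?_)⟩
    simpa using h
  · rintro ⟨φ, v, hv⟩
    refine ⟨ψ.trans (φ.trans ψ.symm), ψ.symm v, fun h => hv (ψ.symm.injective ?_)⟩
    simpa using h

theorem needsBandwidth_symmetryLang (k c d : ℕ) (hc : 1 ≤ c) :
    NeedsBandwidth (1 / 3) k (polyNetworks c d) symmetryLang (fun n => Real.log n) := by
  apply needsBandwidth_log_of_sq_le (k / 2 + 1) 17 (by positivity) (by positivity)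
  filter_upwards [eventually_ge_atTop 12] with n hn b V hV
  -- The ruler absorbs the vertices left over after `h` is fixed.
  obtain ⟨h, M, hh, hM, hn', hhM⟩ : ∃ h M, 0 < h ∧ 2 * h < M ∧ n ≤ 17 * h ∧ n = M + 4 * h + 5 :=
    ⟨(n - 6) / 6, n - 5 - 4 * ((n - 6) / 6), by omega, by omega, by omega, by omega⟩
  refine ⟨h, hn', ?_⟩
  have : Nonempty (SymVertex h M) := ⟨.ruler 0⟩
  have h := hV.card_le_of_graph_fooling hc
    (Fintype.equivFinOfCardEq (SymVertex.card.trans hhM.symm))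
    (ι := Fin h → Fin h → Bool) SymVertex.graph SymVertex.IsAlice
    (fun x y => SymVertex.connected hM) ?_ ?_ ?_ ?_
  · simpa [← pow_mul] using h
  · intro x
    rw [unlabelled_mem_symmetryLang]
    exact ⟨SymVertex.flipIso x, .hub false, fun h => by injection h with h; cases h⟩
  · intro x y h1 _
    rw [unlabelled_mem_symmetryLang] at h1
    obtain ⟨φ, hφ⟩ := h1
    exact SymVertex.eq_of_automorphism hh hM φ hφ
  · intro x y y' v u hv
    cases v <;> cases u <;>
      simp_all [SymVertex.IsAlice, SymVertex.graph, SymVertex.rel]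
    all_goals aesop
  · intro x x' y v u hv
    cases v <;> cases u <;>
      simp_all [SymVertex.IsAlice, SymVertex.graph, SymVertex.rel]
    all_goals aesop

/-! ### Labels can be decoded -/

/-- The number code is self-delimiting: each digit is announced by `true`, the end by `false`. -/
theorem flatMap_true_append_inj {B B' : List Bool} {m m' : Bool} {r r' : List Bool}
    (h : B.flatMap (fun t => [true, t]) ++ false :: m :: r =
      B'.flatMap (fun t => [true, t]) ++ false :: m' :: r') : B = B' ∧ m = m' ∧ r = r' := by
  induction B generalizing B' with
  | nil =>
    cases B' with
    | nil => simpa using h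
    | cons a B' => simp at h
  | cons a B ih =>
    cases B' with
    | nil => simp at h
    | cons a' B' =>
      simp only [List.flatMap_cons, List.cons_append, List.nil_append, List.cons.injEq,
        true_and] at h
      obtain ⟨rfl, h⟩ := h
      obtain ⟨h1, h2⟩ := ih h
      exact ⟨by rw [h1], h2⟩

theorem bits_injective : Function.Injective Nat.bits := by
  intro a b h
  have := congrArg (fun l => Nat.ofDigits 2 (l.map fun b => cond b 1 0)) h
  simpa [Nat.digits_two_eq_bits, ← Nat.digits_two_eq_bits, Nat.ofDigits_digits] using this

theorem encodeLabel_injective : Function.Injective encodeLabel := by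
  intro l
  induction l with
  | nil =>
    rintro (_ | ⟨p, l'⟩) h
    · rfl
    · simp [encodeLabel] at h
  | cons p l ih =>
    rintro (_ | ⟨p', l'⟩) h
    · simp [encodeLabel] at h
    · simp only [encodeLabel, List.flatMap_cons, List.append_assoc, List.cons_append,
        List.nil_append] at h
      obtain ⟨h1, h2, h3⟩ := flatMap_true_append_inj h
      rw [ih h3, Prod.ext (bits_injective h1) h2]

theorem length_encodeLabel_le {l : List (ℕ × Bool)} {q : ℕ} (h : ∀ p ∈ l, p.1.size ≤ q) :
    (encodeLabel l).length ≤ l.length * (2 * q + 2) := by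
  induction l with
  | nil => simp [encodeLabel]
  | cons p l ih =>
    have h1 := ih fun p hp => h p (List.mem_cons_of_mem _ hp)
    have h2 := h p List.mem_cons_self
    rw [← Nat.size_eq_bits_len] at h2
    have h3 : (p.1.bits.flatMap fun t => [true, t]).length = 2 * p.1.bits.length := by
      simp [mul_comm]
    simp only [encodeLabel, List.flatMap_cons, List.length_append, List.length_cons,
      List.length_nil] at h1 ⊢
    rw [h3]
    nlinarith

theorem nodup_ports {n : ℕ} (x : Network n) (v : Fin n) : (x.ports v).Nodup := by
  classical
  unfold Network.ports
  rw [(List.mergeSort_perm _ _).nodup_iff]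
  exact (List.nodup_finRange n).filter _

/-! ### Spanning trees of unicyclic graphs -/

theorem totalWeight_deleteEdges {n : ℕ} {G : SimpleGraph (Fin n)} (w : Sym2 (Fin n) → ℕ)
    {f : Sym2 (Fin n)} (hf : f ∈ G.edgeSet) :
    totalWeight w (G.deleteEdges {f}) + w f = totalWeight w G := by
  classical
  have : (G.deleteEdges {f}).edgeFinset = G.edgeFinset.erase f := by
    ext e
    simp [and_comm]
  unfold totalWeight
  rw [← Finset.sum_erase_add _ _ (SimpleGraph.mem_edgeFinset.2 hf)]
  congr 1
  apply Finset.sum_congr _ fun _ _ => rfl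
  ext e
  simp [and_comm]

/-- A spanning tree has `n - 1` edges, so at most one edge of `G` is missing. -/
theorem eq_deleteEdges_of_isTree {n : ℕ} {G T : SimpleGraph (Fin n)} (hTG : T ≤ G)
    (hT : T.IsTree) (hG : Nat.card G.edgeSet ≤ n) (hne : T ≠ G) :
    ∃ f ∈ G.edgeSet, T = G.deleteEdges {f} := by
  classical
  have h1 := hT.card_edgeFinset
  rw [Fintype.card_fin] at h1
  rw [Nat.card_eq_fintype_card, ← SimpleGraph.edgeFinset_card] at hG
  have hsub : T.edgeFinset ⊆ G.edgeFinset := SimpleGraph.edgeFinset_mono hTG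
  have h2 := Finset.card_sdiff_add_card_eq_card hsub
  have h3 : (G.edgeFinset \ T.edgeFinset).Nonempty := by
    rw [Finset.nonempty_iff_ne_empty, Ne, Finset.sdiff_eq_empty_iff_subset]
    exact fun h => hne (le_antisymm hTG (SimpleGraph.edgeFinset_subset_edgeFinset.1 h))
  have h4 := h3.card_pos
  obtain ⟨f, hf⟩ := Finset.card_eq_one.1 (show (G.edgeFinset \ T.edgeFinset).card = 1 by omega)
  have hmem : ∀ e, (e ∈ G.edgeSet ∧ e ∉ T.edgeSet) ↔ e = f := by
    intro e
    rw [← Finset.mem_singleton, ← hf]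
    simp
  refine ⟨f, ((hmem f).2 rfl).1, ?_⟩
  rw [← SimpleGraph.edgeSet_inj, SimpleGraph.edgeSet_deleteEdges]
  ext e
  rw [Set.mem_sdiff, Set.mem_singleton_iff, ← hmem]
  have : e ∈ T.edgeSet → e ∈ G.edgeSet := fun h => SimpleGraph.edgeSet_mono hTG h
  tauto

theorem isTree_deleteEdges {n : ℕ} {G : SimpleGraph (Fin n)} {f : Sym2 (Fin n)}
    (hf : f ∈ G.edgeSet) (hG : Nat.card G.edgeSet ≤ n) (hc : (G.deleteEdges {f}).Connected) :
    (G.deleteEdges {f}).IsTree := by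
  classical
  rw [SimpleGraph.isTree_iff_connected_and_card]
  refine ⟨hc, ?_⟩
  have h1 := hc.card_vert_le_card_edgeSet_add_one
  have h2 : Nat.card (G.deleteEdges {f}).edgeSet + 1 = Nat.card G.edgeSet := by
    rw [SimpleGraph.edgeSet_deleteEdges]
    have := Set.ncard_sdiff_singleton_add_one hf (Set.toFinite _)
    exact this
  rw [Nat.card_fin] at h1 ⊢
  omega

/-- A competing spanning tree omits at most one edge, and none is heavier than `f`. -/
theorem isMinSpanningTree_deleteEdges {n : ℕ} {G : SimpleGraph (Fin n)} {f : Sym2 (Fin n)}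
    (hf : f ∈ G.edgeSet) (hG : Nat.card G.edgeSet ≤ n) (hc : (G.deleteEdges {f}).Connected)
    {w : Sym2 (Fin n) → ℕ} (hw : ∀ e ∈ G.edgeSet, w e ≤ w f) :
    IsMinSpanningTree G w (G.deleteEdges {f}) := by
  refine ⟨SimpleGraph.deleteEdges_le _, isTree_deleteEdges hf hG hc, fun T hTG hT => ?_⟩
  have h1 := totalWeight_deleteEdges w hf
  by_cases hne : T = G
  · rw [hne]
    omega
  · obtain ⟨e, he, rfl⟩ := eq_deleteEdges_of_isTree hTG hT hG hne
    have h2 := totalWeight_deleteEdges w he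
    have := hw e he
    omega

/-! ### Weighted cycles -/

/-- The cycle on `n` nodes. -/
def cyc (n : ℕ) : SimpleGraph (Fin n) :=
  SimpleGraph.fromRel fun u v => (u : ℕ) + 1 = v ∨ ((u : ℕ) + 1 = n ∧ (v : ℕ) = 0)

theorem cyc_adj {n : ℕ} (hn : 2 ≤ n) {u v : Fin n} : (cyc n).Adj u v ↔
    (u : ℕ) + 1 = v ∨ ((u : ℕ) + 1 = n ∧ (v : ℕ) = 0) ∨
      (v : ℕ) + 1 = u ∨ ((v : ℕ) + 1 = n ∧ (u : ℕ) = 0) := by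
  simp only [cyc, SimpleGraph.fromRel_adj, ne_eq, Fin.ext_iff]
  omega

theorem card_edgeSet_cyc_le {n : ℕ} (hn : 2 ≤ n) : Nat.card (cyc n).edgeSet ≤ n := by
  classical
  let g : Fin n → Sym2 (Fin n) := fun i =>
    s(i, if h : (i : ℕ) + 1 < n then ⟨i + 1, h⟩ else ⟨0, by omega⟩)
  have hsub : (cyc n).edgeSet ⊆ Set.range g := by
    intro e
    induction e using Sym2.ind with
    | _ u v =>
      rw [SimpleGraph.mem_edgeSet, cyc_adj hn]
      have aux : ∀ u v : Fin n, ((u : ℕ) + 1 = v ∨ ((u : ℕ) + 1 = n ∧ (v : ℕ) = 0)) →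
          g u = s(u, v) := by
        intro u v h
        simp only [g]
        congr
        split_ifs with h' <;> apply Fin.ext <;> dsimp only <;> omega
      rintro (h | h | h | h)
      · exact ⟨u, aux u v (.inl h)⟩
      · exact ⟨u, aux u v (.inr h)⟩
      · exact ⟨v, (aux v u (.inl h)).trans Sym2.eq_swap⟩
      · exact ⟨v, (aux v u (.inr h)).trans Sym2.eq_swap⟩
  calc Nat.card (cyc n).edgeSet ≤ Nat.card (Set.range g) :=
        Nat.card_mono (Set.toFinite _) hsub
    _ ≤ Nat.card (Fin n) := Finite.card_range_le g
    _ = n := Nat.card_fin n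

section

variable {n : ℕ} (hn : 5 ≤ n)

/-- The edge of the cycle whose weight is held by the first player. -/
def edgeA : Sym2 (Fin n) := s(⟨1, by omega⟩, ⟨2, by omega⟩)

/-- The edge of the cycle whose weight is held by the second player. -/
def edgeB : Sym2 (Fin n) := s(⟨n - 1, by omega⟩, ⟨0, by omega⟩)

theorem mk_eq_edgeA {u v : Fin n} : s(u, v) = edgeA hn ↔
    ((u : ℕ) = 1 ∧ (v : ℕ) = 2) ∨ ((u : ℕ) = 2 ∧ (v : ℕ) = 1) := by
  simp [edgeA, Fin.ext_iff]

theorem mk_eq_edgeB {u v : Fin n} : s(u, v) = edgeB hn ↔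
    ((u : ℕ) = n - 1 ∧ (v : ℕ) = 0) ∨ ((u : ℕ) = 0 ∧ (v : ℕ) = n - 1) := by
  simp [edgeB, Fin.ext_iff]

theorem edgeA_mem : edgeA hn ∈ (cyc n).edgeSet := by
  rw [edgeA, SimpleGraph.mem_edgeSet, cyc_adj (by omega)]
  simp

theorem edgeB_mem : edgeB hn ∈ (cyc n).edgeSet := by
  rw [edgeB, SimpleGraph.mem_edgeSet, cyc_adj (by omega)]
  dsimp only
  omega

theorem edgeB_ne_edgeA : edgeB hn ≠ edgeA hn := by
  rw [edgeB, Ne, mk_eq_edgeA]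
  dsimp only
  omega

theorem cyc_deleteEdges_edgeB_connected : ((cyc n).deleteEdges {edgeB hn}).Connected := by
  rw [SimpleGraph.connected_iff_exists_forall_reachable]
  refine ⟨⟨0, by omega⟩, fun ⟨i, hi⟩ => ?_⟩
  induction i with
  | zero => exact .rfl
  | succ i ih =>
    refine (ih (by omega)).trans (SimpleGraph.Adj.reachable ?_)
    rw [SimpleGraph.deleteEdges_adj, cyc_adj (by omega), Set.mem_singleton_iff, mk_eq_edgeB]
    dsimp only
    omega

theorem cyc_deleteEdges_edgeA_connected : ((cyc n).deleteEdges {edgeA hn}).Connected := by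
  rw [SimpleGraph.connected_iff_exists_forall_reachable]
  have hadj : ∀ u v : Fin n, ((cyc n).deleteEdges {edgeA hn}).Adj u v ↔
      ((u : ℕ) + 1 = v ∨ ((u : ℕ) + 1 = n ∧ (v : ℕ) = 0) ∨
      (v : ℕ) + 1 = u ∨ ((v : ℕ) + 1 = n ∧ (u : ℕ) = 0)) ∧
      ¬ (((u : ℕ) = 1 ∧ (v : ℕ) = 2) ∨ ((u : ℕ) = 2 ∧ (v : ℕ) = 1)) := by
    intro u v
    rw [SimpleGraph.deleteEdges_adj, cyc_adj (by omega), Set.mem_singleton_iff, mk_eq_edgeA]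
  have h2 : ∀ d i : ℕ, (hi : i < n) → 2 ≤ i → i + d = n - 1 →
      ((cyc n).deleteEdges {edgeA hn}).Reachable ⟨n - 1, by omega⟩ ⟨i, hi⟩ := by
    intro d
    induction d with
    | zero =>
      rintro i hi - rfl
      exact .rfl
    | succ d ih =>
      intro i hi h2 hd
      refine (ih (i + 1) (by omega) (by omega) (by omega)).trans (SimpleGraph.Adj.reachable ?_)
      rw [hadj]
      dsimp only
      omega
  have h0 : ((cyc n).deleteEdges {edgeA hn}).Adj ⟨n - 1, by omega⟩ ⟨0, by omega⟩ := by
    rw [hadj]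
    dsimp only
    omega
  have h1 : ((cyc n).deleteEdges {edgeA hn}).Adj ⟨0, by omega⟩ ⟨1, by omega⟩ := by
    rw [hadj]
    dsimp only
    omega
  refine ⟨⟨n - 1, by omega⟩, fun ⟨i, hi⟩ => ?_⟩
  match i, hi with
  | 0, _ => exact h0.reachable
  | 1, _ => exact h0.reachable.trans h1.reachable
  | i + 2, hi => exact h2 (n - 1 - (i + 2)) (i + 2) hi (by omega) (by omega)

theorem cyc_connected {n : ℕ} (hn : 5 ≤ n) : (cyc n).Connected :=
  (cyc_deleteEdges_edgeB_connected hn).mono (SimpleGraph.deleteEdges_le _)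

/-- The weights on the cycle. -/
def cycWeight (s t : Fin n) (e : Sym2 (Fin n)) : ℕ :=
  if e = edgeA hn then s + 1 else if e = edgeB hn then t + 1 else 1

theorem one_le_cycWeight (s t : Fin n) (e : Sym2 (Fin n)) : 1 ≤ cycWeight hn s t e := by
  unfold cycWeight
  split_ifs <;> omega

theorem cycWeight_le (s t : Fin n) (e : Sym2 (Fin n)) : cycWeight hn s t e ≤ n := by
  unfold cycWeight
  split_ifs <;> omega

open Classical in
/-- The weighted cycle with all edges marked except one. -/
noncomputable def cycNetwork (s t : Fin n) : Network n where
  graph := cyc n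
  connected := cyc_connected hn
  ident v := v + 1
  ident_injective := fun v w h => Fin.ext (by simpa using h)
  input v := encodeLabel (((unlabelled (Equiv.refl _) (cyc n) (cyc_connected hn)).ports v).map
    fun u => (cycWeight hn s t s(v, u), decide (((cyc n).deleteEdges {edgeB hn}).Adj v u)))

theorem cycNetwork_encodesWeighted (s t : Fin n) :
    EncodesWeighted (cycNetwork hn s t) (cycWeight hn s t) ((cyc n).deleteEdges {edgeB hn}) :=
  ⟨SimpleGraph.deleteEdges_le _, fun v => congrArg encodeLabel
    (List.map_congr_left fun u _ => by congr)⟩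

theorem length_ports_cycNetwork_le (s t v : Fin n) :
    ((cycNetwork hn s t).ports v).length ≤ 2 := by
  have hsub : (cycNetwork hn s t).ports v ⊆
      [⟨if (v : ℕ) + 1 = n then 0 else v + 1, by split_ifs <;> omega⟩,
        ⟨if (v : ℕ) = 0 then n - 1 else v - 1, by split_ifs <;> omega⟩] := by
    intro u hu
    rw [mem_ports] at hu
    have hu : (cyc n).Adj v u := hu
    rw [cyc_adj (by omega)] at hu
    simp only [List.mem_cons, List.not_mem_nil, or_false, Fin.ext_iff]
    split_ifs <;> omega
  exact (List.subperm_of_subset (nodup_ports _ v) hsub).length_le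

/-- Two label entries of `2 * (n / 8) + 2` bits each fit into length `n`. The bound 48 makes `q = n
/ 8` at least 6, where `8 * q + 8 ≤ 2 ^ q` begins to hold. -/
theorem size_le_div_eight {n : ℕ} (hn : 48 ≤ n) : n.size ≤ n / 8 := by
  rw [Nat.size_le]
  have h : ∀ q, 6 ≤ q → 8 * q + 8 ≤ 2 ^ q := by
    intro q hq
    induction q, hq using Nat.le_induction with
    | base => norm_num
    | succ q _ ih =>
      rw [pow_succ]
      omega
  have := h (n / 8) (by omega)
  omega

theorem cycNetwork_mem_weightedNetworks (hn' : 48 ≤ n) {c d e : ℕ} (hc : 1 ≤ c) (hd : 1 ≤ d)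
    (he : 1 ≤ e) (s t : Fin n) : cycNetwork hn s t ∈ weightedNetworks c d e n := by
  have hpow : ∀ a, 1 ≤ a → n ≤ n ^ a := fun a ha => Nat.le_self_pow (by omega) n
  refine ⟨⟨fun v => ⟨by simp [cycNetwork], ?_⟩, fun v => ?_⟩, cycWeight hn s t, _,
    cycNetwork_encodesWeighted hn s t, fun f _ => ⟨one_le_cycWeight hn s t f,
      (cycWeight_le hn s t f).trans (hpow e he)⟩⟩
  · have := hpow c hc
    have := v.2
    simp only [cycNetwork]
    omega
  · refine le_trans ?_ (hpow d hd)
    rw [(cycNetwork_encodesWeighted hn s t).2 v]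
    have h1 := size_le_div_eight hn'
    refine (length_encodeLabel_le (q := n / 8) ?_).trans ?_
    · intro p hp
      obtain ⟨u, -, rfl⟩ := List.mem_map.1 hp
      exact (Nat.size_le_size (cycWeight_le hn s t _)).trans h1
    · rw [List.length_map]
      calc _ ≤ 2 * (2 * (n / 8) + 2) :=
            Nat.mul_le_mul_right _ (length_ports_cycNetwork_le hn s t v)
        _ ≤ n := by omega

theorem cycNetwork_mem_mstLang (s : Fin n) : cycNetwork hn s s ∈ mstLang n := by
  refine ⟨_, _, cycNetwork_encodesWeighted hn s s, ?_⟩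
  refine isMinSpanningTree_deleteEdges (edgeB_mem hn) (card_edgeSet_cyc_le (by omega))
    (cyc_deleteEdges_edgeB_connected hn) fun e _ => ?_
  unfold cycWeight
  rw [if_neg (edgeB_ne_edgeA hn), if_pos rfl]
  split_ifs <;> omega

/-- Membership in `mstLang` quantifies over all decodings; proving non-membership requires that
there is only one. -/
theorem EncodesWeighted.unique {n : ℕ} {x : Network n} {w w' : Sym2 (Fin n) → ℕ}
    {T T' : SimpleGraph (Fin n)} (h : EncodesWeighted x w T) (h' : EncodesWeighted x w' T') :
    T = T' ∧ ∀ e ∈ x.graph.edgeSet, w e = w' e := by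
  have key : ∀ v u, x.graph.Adj v u → w s(v, u) = w' s(v, u) ∧ (T.Adj v u ↔ T'.Adj v u) := by
    intro v u hvu
    have h1 := encodeLabel_injective ((h.2 v).symm.trans (h'.2 v))
    have h2 := List.map_inj_left.1 h1 u (mem_ports x |>.2 hvu)
    simpa using h2
  constructor
  · ext v u
    exact ⟨fun hT => ((key v u (h.1 hT)).2).1 hT, fun hT => ((key v u (h'.1 hT)).2).2 hT⟩
  · intro e
    induction e using Sym2.ind with
    | _ v u => exact fun he => (key v u he).1

/-- The marked tree omits `edgeB`; it is compared with the tree that omits `edgeA`. -/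
theorem le_of_cycNetwork_mem_mstLang {s t : Fin n} (h : cycNetwork hn s t ∈ mstLang n) :
    s ≤ t := by
  obtain ⟨w, T, hE, hT⟩ := h
  obtain ⟨rfl, hw⟩ := (cycNetwork_encodesWeighted hn s t).unique hE
  have h1 := hT.2.2 ((cyc n).deleteEdges {edgeA hn}) (SimpleGraph.deleteEdges_le _)
    (isTree_deleteEdges (edgeA_mem hn) (card_edgeSet_cyc_le (by omega))
      (cyc_deleteEdges_edgeA_connected hn))
  have h2 := totalWeight_deleteEdges w (edgeA_mem hn)
  have h3 := totalWeight_deleteEdges w (edgeB_mem hn)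
  have h4 := hw _ (edgeA_mem hn)
  have h5 := hw _ (edgeB_mem hn)
  simp only [cycWeight, if_neg (edgeB_ne_edgeA hn), if_true] at h4 h5
  rw [Fin.le_def]
  omega

theorem le_of_decides_mstLang {k b c d e : ℕ} (hn' : 48 ≤ n) (hc : 1 ≤ c) (hd : 1 ≤ d)
    (he : 1 ≤ e) {V : Verifier k b}
    (hV : V.Decides (1 / 3) (weightedNetworks c d e n) (mstLang n)) :
    n ≤ 2 ^ (2 ^ (b * (k / 2 + 1)) * 4) := by
  classical
  have hn : 5 ≤ n := by omega
  -- The first player owns nodes 1 and 2, so the cut consists of the edges 0–1 and 2–3.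
  let W : Finset (Fin n) :=
    {⟨0, by omega⟩, ⟨1, by omega⟩, ⟨2, by omega⟩, ⟨3, by omega⟩}
  have hW : ∀ u : Fin n, u ∉ W → 4 ≤ (u : ℕ) := by
    intro u hu
    simp only [W, Finset.mem_insert, Finset.mem_singleton, Fin.ext_iff] at hu
    omega
  have h := hV.card_le_of_fooling (W := W) ⟨_, Finset.mem_insert_self _ _⟩ (cycNetwork hn)
    (fun v => (v : ℕ) = 1 ∨ (v : ℕ) = 2)
    (fun s t => cycNetwork_mem_weightedNetworks hn hn' hc hd he s t)
    (cycNetwork_mem_mstLang hn)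
    (fun s t h h' => le_antisymm (le_of_cycNetwork_mem_mstLang hn h)
      (le_of_cycNetwork_mem_mstLang hn h'))
    (fun _ _ _ _ => rfl) ?_ ?_ (fun _ _ _ _ _ _ => Iff.rfl) (fun _ _ _ _ _ _ => Iff.rfl) ?_
  · rw [Fintype.card_fin] at h
    refine h.trans (Nat.pow_le_pow_right (by norm_num) (Nat.mul_le_mul_left _ ?_))
    exact Finset.card_le_four
  · intro s t t' v hv
    refine congrArg encodeLabel (List.map_congr_left fun u _ => ?_)
    have : s(v, u) ≠ edgeB hn := by
      rw [Ne, mk_eq_edgeB]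
      omega
    simp only [cycWeight, if_neg this]
  · intro s s' t v hv
    refine congrArg encodeLabel (List.map_congr_left fun u _ => ?_)
    have : s(v, u) ≠ edgeA hn := by
      rw [Ne, mk_eq_edgeA]
      omega
    simp only [cycWeight, if_neg this]
  · intro s t v u hvu hu
    have hvu : (cyc n).Adj v u := hvu
    rw [cyc_adj (by omega)] at hvu
    have := hW u hu
    omega

end

theorem needsBandwidth_mstLang (k c d e : ℕ) (hc : 1 ≤ c) (hd : 1 ≤ d) (he : 1 ≤ e) :
    NeedsBandwidth (1 / 3) k (weightedNetworks c d e) mstLang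
      (fun n => Real.log (Real.log n)) := by
  apply needsBandwidth_of_eventually_le (a := 1) (C := Real.log 4)
    (K := (k / 2 + 1 : ℕ) * Real.log 2)
    (Real.tendsto_log_atTop.comp (Real.tendsto_log_atTop.comp tendsto_natCast_atTop_atTop))
    one_pos (mul_pos (by positivity) (Real.log_pos (by norm_num)))
  filter_upwards [eventually_ge_atTop 48] with n hn b V hV
  have h := le_of_decides_mstLang hn hc hd he hV
  have hn1 : (1 : ℝ) < n := by exact_mod_cast (by omega : 1 < n)
  have h1 : Real.log n ≤ 2 ^ (b * (k / 2 + 1)) * 4 := by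
    have h2 : (n : ℝ) ≤ 2 ^ (2 ^ (b * (k / 2 + 1)) * 4) := by exact_mod_cast h
    have h3 := Real.log_le_log (by linarith) h2
    rw [Real.log_pow] at h3
    push_cast at h3
    refine h3.trans (mul_le_of_le_one_right (by positivity) ?_)
    linarith [Real.log_two_lt_d9]
  have h2 := Real.log_le_log (Real.log_pos hn1) h1
  rw [Real.log_mul (by positivity) (by norm_num), Real.log_pow] at h2
  push_cast at h2 ⊢
  simp only [Function.comp_apply]
  linarith

/-! ### Discrepancy of three-party set disjointness -/

section Discrepancy

variable {X Y Z : Type*} [Fintype X] [Fintype Y] [Fintype Z]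

/-- The cube bound for the correlation of a function with a cylinder intersection. -/
theorem sq_sum_mul_cylinder_le (F : X → Y → Z → ℝ) (χ₁ : Y → Z → ℝ) (χ₂ : X → Z → ℝ)
    (χ₃ : X → Y → ℝ) (h₁ : ∀ y z, |χ₁ y z| ≤ 1) (h₂ : ∀ x z, |χ₂ x z| ≤ 1)
    (h₃ : ∀ x y, |χ₃ x y| ≤ 1) (s : Z → Z → ℝ) (hs : ∀ z z', 0 ≤ s z z')
    (hF : ∀ z z', (Fintype.card X : ℝ) *
      ∑ y, ∑ y', |∑ x, F x y z * F x y z' * (F x y' z * F x y' z')| ≤ s z z' ^ 2) :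
    (∑ x, ∑ y, ∑ z, F x y z * (χ₁ y z * χ₂ x z * χ₃ x y)) ^ 2 ≤
      Fintype.card X * Fintype.card Y * ∑ z, ∑ z', s z z' := by
  have sq_le (a : ℝ) (h : |a| ≤ 1) : a ^ 2 ≤ 1 := (sq_le_one_iff_abs_le_one a).2 h
  -- the first application of the Cauchy-Schwarz inequality
  have step1 : (∑ x, ∑ y, ∑ z, F x y z * (χ₁ y z * χ₂ x z * χ₃ x y)) ^ 2 ≤
      Fintype.card X * Fintype.card Y * ∑ x, ∑ y, (∑ z, F x y z * χ₁ y z * χ₂ x z) ^ 2 := by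
    have e1 : ∑ x, ∑ y, ∑ z, F x y z * (χ₁ y z * χ₂ x z * χ₃ x y) =
        ∑ p : X × Y, χ₃ p.1 p.2 * ∑ z, F p.1 p.2 z * χ₁ p.2 z * χ₂ p.1 z := by
      rw [Fintype.sum_prod_type]
      refine Finset.sum_congr rfl fun x _ => Finset.sum_congr rfl fun y _ => ?_
      rw [Finset.mul_sum]
      refine Finset.sum_congr rfl fun z _ => ?_
      ring
    have e2 : ∑ x, ∑ y, (∑ z, F x y z * χ₁ y z * χ₂ x z) ^ 2 =
        ∑ p : X × Y, (∑ z, F p.1 p.2 z * χ₁ p.2 z * χ₂ p.1 z) ^ 2 := by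
      rw [Fintype.sum_prod_type]
    rw [e1, e2]
    refine (Finset.sum_mul_sq_le_sq_mul_sq _ _ _).trans ?_
    refine mul_le_mul_of_nonneg_right ?_ (Finset.sum_nonneg fun _ _ => sq_nonneg _)
    calc ∑ p : X × Y, χ₃ p.1 p.2 ^ 2 ≤ ∑ _p : X × Y, (1 : ℝ) :=
          Finset.sum_le_sum fun p _ => sq_le _ (h₃ _ _)
      _ = _ := by simp [Fintype.card_prod]
  refine step1.trans (mul_le_mul_of_nonneg_left ?_ (by positivity))
  have step2 : ∑ x, ∑ y, (∑ z, F x y z * χ₁ y z * χ₂ x z) ^ 2 =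
      ∑ z, ∑ z', ∑ x, (χ₂ x z * χ₂ x z') * ∑ y, F x y z * F x y z' * (χ₁ y z * χ₁ y z') := by
    have e0 (x : X) (y : Y) : (∑ z, F x y z * χ₁ y z * χ₂ x z) ^ 2 =
        ∑ z, ∑ z', F x y z * χ₁ y z * χ₂ x z * (F x y z' * χ₁ y z' * χ₂ x z') := by
      rw [sq, Finset.sum_mul_sum]
    simp only [e0, Finset.mul_sum]
    have e (x : X) : ∑ y, ∑ z, ∑ z', F x y z * χ₁ y z * χ₂ x z * (F x y z' * χ₁ y z' * χ₂ x z') =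
        ∑ z, ∑ z', ∑ y, χ₂ x z * χ₂ x z' * (F x y z * F x y z' * (χ₁ y z * χ₁ y z')) := by
      rw [Finset.sum_comm]
      refine Finset.sum_congr rfl fun z _ => ?_
      rw [Finset.sum_comm]
      refine Finset.sum_congr rfl fun z' _ => Finset.sum_congr rfl fun y _ => ?_
      ring
    simp only [e]
    rw [Finset.sum_comm]
    refine Finset.sum_congr rfl fun z _ => ?_
    rw [Finset.sum_comm]
  rw [step2]
  refine Finset.sum_le_sum fun z _ => Finset.sum_le_sum fun z' _ => ?_
  -- the second application of the Cauchy-Schwarz inequality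
  apply le_of_sq_le_sq _ (hs z z')
  refine le_trans ?_ (hF z z')
  refine (Finset.sum_mul_sq_le_sq_mul_sq _ _ _).trans ?_
  refine mul_le_mul ?_ ?_ (Finset.sum_nonneg fun _ _ => sq_nonneg _) (by positivity)
  · calc ∑ x, (χ₂ x z * χ₂ x z') ^ 2 ≤ ∑ _x : X, (1 : ℝ) :=
          Finset.sum_le_sum fun x _ => by
            rw [mul_pow]
            exact mul_le_one₀ (sq_le _ (h₂ _ _)) (sq_nonneg _) (sq_le _ (h₂ _ _))
      _ = _ := by simp
  · simp only [sq, Finset.sum_mul_sum]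
    rw [Finset.sum_comm]
    refine Finset.sum_le_sum fun y _ => ?_
    rw [Finset.sum_comm]
    refine Finset.sum_le_sum fun y' _ => ?_
    -- The factors `χ₁` do not involve `x`; they leave the sum and are bounded by one.
    have e : ∑ x, F x y z * F x y z' * (χ₁ y z * χ₁ y z') *
          (F x y' z * F x y' z' * (χ₁ y' z * χ₁ y' z')) =
        (χ₁ y z * χ₁ y z' * (χ₁ y' z * χ₁ y' z')) *
          ∑ x, F x y z * F x y z' * (F x y' z * F x y' z') := by
      rw [Finset.mul_sum]
      refine Finset.sum_congr rfl fun x _ => ?_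
      ring
    rw [e]
    refine (le_abs_self _).trans ?_
    rw [abs_mul]
    refine mul_le_of_le_one_left (abs_nonneg _) ?_
    rw [abs_mul, abs_mul, abs_mul]
    exact mul_le_one₀ (mul_le_one₀ (h₁ _ _) (abs_nonneg _) (h₁ _ _)) (by positivity)
      (mul_le_one₀ (h₁ _ _) (abs_nonneg _) (h₁ _ _))

end Discrepancy

section Disjointness

variable {I : Type*} [Fintype I]

theorem sum_prod_apply [DecidableEq I] {κ : Type*} [Fintype κ] (f : I → κ → ℝ) :
    ∑ x : I → κ, ∏ i, f i (x i) = ∏ i, ∑ a, f i a := by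
  classical
  rw [Finset.prod_univ_sum, Fintype.piFinset_univ]

theorem sum_sum_prod_apply [DecidableEq I] {κ : Type*} [Fintype κ] (f : I → κ → κ → ℝ) :
    ∑ x : I → κ, ∑ y : I → κ, ∏ i, f i (x i) (y i) = ∏ i, ∑ a, ∑ b, f i a b := by
  rw [← sum_prod_apply]
  exact Finset.sum_congr rfl fun x _ => sum_prod_apply _

/-- The weights of the hard distribution at one coordinate. -/
def coordWeight : Bool → Bool → ℝ
  | false, _ => 2
  | true, false => 3
  | true, true => 1

/-- The weights, with a sign at the intersecting point. -/
def signedWeight (a b c : Bool) : ℝ := (if a && b && c then -1 else 1) * coordWeight b c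

/-- The weights, restricted to the disjoint points. -/
def disjWeight (a b c : Bool) : ℝ := (if a && b && c then 0 else 1) * coordWeight b c

theorem coordWeight_nonneg (b c : Bool) : 0 ≤ coordWeight b c := by
  cases b <;> cases c <;> norm_num [coordWeight]

/-- The square root of the cube norm at one coordinate. -/
def cubeWeight (c c' : Bool) : ℝ := if c || c' then 10 else 26

/-- The hard weights are chosen so that signs cancel when `c ≠ c'`. All four values are perfect
squares, as the second Cauchy–Schwarz step wants. -/
theorem cube_coord (c c' : Bool) : 2 * ∑ b, ∑ b', |∑ a, signedWeight a b c * signedWeight a b c' *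
    (signedWeight a b' c * signedWeight a b' c')| = cubeWeight c c' ^ 2 := by
  cases c <;> cases c' <;>
    norm_num [signedWeight, coordWeight, cubeWeight, abs_of_pos]

/-- Everything factors over the coordinates. Each contributes `2 * 2` from the sizes of the ranges
of `x` and `y`, and `26 + 3 * 10 = 56` from `cubeWeight`; the product is 224. -/
theorem sq_sum_signedWeight_le [DecidableEq I] (χ₁ χ₂ χ₃ : (I → Bool) → (I → Bool) → ℝ)
    (h₁ : ∀ y z, |χ₁ y z| ≤ 1) (h₂ : ∀ x z, |χ₂ x z| ≤ 1) (h₃ : ∀ x y, |χ₃ x y| ≤ 1) :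
    (∑ x : I → Bool, ∑ y : I → Bool, ∑ z : I → Bool,
      (∏ i, signedWeight (x i) (y i) (z i)) * (χ₁ y z * χ₂ x z * χ₃ x y)) ^ 2 ≤
      224 ^ Fintype.card I := by
  have hpos : ∀ z z' : I → Bool, 0 ≤ ∏ i, cubeWeight (z i) (z' i) := fun z z' =>
    Finset.prod_nonneg fun i _ => by
      unfold cubeWeight
      split_ifs <;> norm_num
  refine (sq_sum_mul_cylinder_le _ χ₁ χ₂ χ₃ h₁ h₂ h₃ (fun z z' => ∏ i, cubeWeight (z i) (z' i))
    hpos fun z z' => ?_).trans ?_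
  · simp only [← Finset.prod_mul_distrib]
    have e (y y' : I → Bool) : ∑ x : I → Bool, ∏ i, signedWeight (x i) (y i) (z i) *
        signedWeight (x i) (y i) (z' i) *
          (signedWeight (x i) (y' i) (z i) * signedWeight (x i) (y' i) (z' i)) =
        ∏ i, ∑ a, signedWeight a (y i) (z i) * signedWeight a (y i) (z' i) *
          (signedWeight a (y' i) (z i) * signedWeight a (y' i) (z' i)) :=
      sum_prod_apply fun i a => signedWeight a (y i) (z i) * signedWeight a (y i) (z' i) *
        (signedWeight a (y' i) (z i) * signedWeight a (y' i) (z' i))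
    simp only [e, Finset.abs_prod]
    rw [sum_sum_prod_apply fun i b b' => |∑ a, signedWeight a b (z i) * signedWeight a b (z' i) *
      (signedWeight a b' (z i) * signedWeight a b' (z' i))|]
    rw [← Finset.prod_pow]
    simp only [← cube_coord]
    rw [Finset.prod_mul_distrib]
    simp
  · rw [sum_sum_prod_apply fun _ => cubeWeight]
    have : ∑ a, ∑ b, cubeWeight a b = 56 := by norm_num [cubeWeight]
    simp only [this, Finset.prod_const, Finset.card_univ, Fintype.card_fun, Fintype.card_bool]
    push_cast
    rw [← mul_pow, ← mul_pow]
    norm_num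

/-- One coordinate has total weight 16, of which the intersecting point takes 1. The gap between `15
^ 2` and 224 drives the bound. -/
theorem sum_disjWeight [DecidableEq I] : ∑ x : I → Bool, ∑ y : I → Bool, ∑ z : I → Bool,
    ∏ i, disjWeight (x i) (y i) (z i) = 15 ^ Fintype.card I := by
  have e (x : I → Bool) : ∑ y : I → Bool, ∑ z : I → Bool, ∏ i, disjWeight (x i) (y i) (z i) =
      ∏ i, ∑ b, ∑ c, disjWeight (x i) b c := sum_sum_prod_apply fun i => disjWeight (x i)
  simp only [e]
  rw [sum_prod_apply fun _ a => ∑ b, ∑ c, disjWeight a b c]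
  have : ∑ a, ∑ b, ∑ c, disjWeight a b c = 15 := by norm_num [disjWeight, coordWeight]
  simp only [this, Finset.prod_const, Finset.card_univ]

/-- Three sets, given by their characteristic functions, have no common element. -/
def NoCommon (x y z : I → Bool) : Prop := ∀ i, (x i && y i && z i) = false

theorem prod_signedWeight_eq {x y z : I → Bool} (h : NoCommon x y z) :
    ∏ i, signedWeight (x i) (y i) (z i) = ∏ i, disjWeight (x i) (y i) (z i) :=
  Finset.prod_congr rfl fun i _ => by simp [signedWeight, disjWeight, h i]

theorem prod_disjWeight_eq_zero {x y z : I → Bool} (h : ¬ NoCommon x y z) :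
    ∏ i, disjWeight (x i) (y i) (z i) = 0 := by
  simp only [NoCommon, not_forall, Bool.not_eq_false] at h
  obtain ⟨i, hi⟩ := h
  exact Finset.prod_eq_zero (Finset.mem_univ i) (by simp [disjWeight, hi])

theorem prod_disjWeight_nonneg (x y z : I → Bool) : 0 ≤ ∏ i, disjWeight (x i) (y i) (z i) :=
  Finset.prod_nonneg fun i _ => mul_nonneg (by split_ifs <;> norm_num) (coordWeight_nonneg _ _)

/-- If the triples of sets without common element are coloured with few colours, there is a
monochromatic star whose centre is a triple with a common element. -/
theorem exists_monochromatic_star {S : Type*} [Fintype S]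
    (sig : (I → Bool) → (I → Bool) → (I → Bool) → S)
    (hS : (Fintype.card S : ℝ) ^ 2 * 224 ^ Fintype.card I < 225 ^ Fintype.card I) :
    ∃ x y z x' y' z' : I → Bool, ¬ NoCommon x y z ∧ NoCommon x' y z ∧ NoCommon x y' z ∧
      NoCommon x y z' ∧ sig x' y z = sig x y' z ∧ sig x' y z = sig x y z' := by
  classical
  by_contra! hno
  refine hS.not_ge ?_
  -- These indicators describe the smallest cylinder intersection containing the disjoint triples of
  -- colour `σ`.
  let χ₁ : S → (I → Bool) → (I → Bool) → ℝ := fun σ y z =>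
    if ∃ x, NoCommon x y z ∧ sig x y z = σ then 1 else 0
  let χ₂ : S → (I → Bool) → (I → Bool) → ℝ := fun σ x z =>
    if ∃ y, NoCommon x y z ∧ sig x y z = σ then 1 else 0
  let χ₃ : S → (I → Bool) → (I → Bool) → ℝ := fun σ x y =>
    if ∃ z, NoCommon x y z ∧ sig x y z = σ then 1 else 0
  have hχ : ∀ (P : Prop) [Decidable P], |if P then (1 : ℝ) else 0| ≤ 1 := by
    intro P _
    split_ifs <;> simp
  have hσ : ∀ σ, ∑ x : I → Bool, ∑ y : I → Bool, ∑ z : I → Bool,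
      (∏ i, signedWeight (x i) (y i) (z i)) * (χ₁ σ y z * χ₂ σ x z * χ₃ σ x y) ≤
      √(224 ^ Fintype.card I) := fun σ => Real.le_sqrt_of_sq_le
    (sq_sum_signedWeight_le (χ₁ σ) (χ₂ σ) (χ₃ σ) (fun _ _ => hχ _) (fun _ _ => hχ _)
      fun _ _ => hχ _)
  -- At a triple with a common element, three nonzero indicators would form the excluded star, so
  -- the negative signs never contribute.
  have hpt : ∀ σ (x y z : I → Bool),
      (if sig x y z = σ then ∏ i, disjWeight (x i) (y i) (z i) else 0) ≤
      (∏ i, signedWeight (x i) (y i) (z i)) * (χ₁ σ y z * χ₂ σ x z * χ₃ σ x y) := by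
    intro σ x y z
    by_cases hd : NoCommon x y z
    · rw [prod_signedWeight_eq hd]
      split_ifs with hsig
      · have e1 : χ₁ σ y z = 1 := if_pos ⟨x, hd, hsig⟩
        have e2 : χ₂ σ x z = 1 := if_pos ⟨y, hd, hsig⟩
        have e3 : χ₃ σ x y = 1 := if_pos ⟨z, hd, hsig⟩
        rw [e1, e2, e3]
        simp
      · refine mul_nonneg (prod_disjWeight_nonneg x y z) (mul_nonneg (mul_nonneg ?_ ?_) ?_) <;>
          dsimp only [χ₁, χ₂, χ₃] <;> split_ifs <;> norm_num
    · rw [prod_disjWeight_eq_zero hd, ite_self]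
      have : χ₁ σ y z * χ₂ σ x z * χ₃ σ x y = 0 := by
        by_contra hne
        simp only [mul_eq_zero, not_or, χ₁, χ₂, χ₃, ite_eq_right_iff, one_ne_zero,
          imp_false, not_not] at hne
        obtain ⟨⟨⟨x', hx, hx'⟩, y', hy, hy'⟩, z', hz, hz'⟩ := hne
        exact hno x y z x' y' z' hd hx hy hz (hx'.trans hy'.symm) (hx'.trans hz'.symm)
      rw [this, mul_zero]
  have hsum : (15 : ℝ) ^ Fintype.card I ≤ Fintype.card S * √(224 ^ Fintype.card I) := by
    rw [← sum_disjWeight]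
    calc ∑ x : I → Bool, ∑ y : I → Bool, ∑ z : I → Bool, ∏ i, disjWeight (x i) (y i) (z i)
        = ∑ σ, ∑ x : I → Bool, ∑ y : I → Bool, ∑ z : I → Bool,
          (if sig x y z = σ then ∏ i, disjWeight (x i) (y i) (z i) else 0) := by
          have e (x y z : I → Bool) : ∏ i, disjWeight (x i) (y i) (z i) =
              ∑ σ, if sig x y z = σ then ∏ i, disjWeight (x i) (y i) (z i) else 0 := by simp
          refine (Finset.sum_congr rfl fun x _ => ?_).trans Finset.sum_comm
          refine (Finset.sum_congr rfl fun y _ => ?_).trans Finset.sum_comm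
          exact (Finset.sum_congr rfl fun z _ => e x y z).trans Finset.sum_comm
      _ ≤ ∑ _σ : S, √(224 ^ Fintype.card I) := Finset.sum_le_sum fun σ _ =>
          (Finset.sum_le_sum fun x _ => Finset.sum_le_sum fun y _ => Finset.sum_le_sum fun z _ =>
            hpt σ x y z).trans (hσ σ)
      _ = _ := by simp
  have h := pow_le_pow_left₀ (by positivity) hsum 2
  rw [mul_pow, Real.sq_sqrt (by positivity), ← pow_mul, mul_comm _ 2, pow_mul] at h
  norm_num at h
  exact h

end Disjointness

/-! ### Triangle-freeness -/

/-- Vertices of the triangle construction: three classes of core vertices, a spare neighbour for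
each of them, other spare vertices, and a hub. -/
inductive TriVertex (l r : ℕ)
  | core (a : Fin 3) (i : Fin l)
  | mid (a : Fin 3) (i : Fin l)
  | spare (j : Fin r)
  | hub
  deriving DecidableEq, Fintype

namespace TriVertex

variable {l r : ℕ}

theorem card : Fintype.card (TriVertex l r) = 6 * l + r + 1 := by
  rw [← Fintype.card_congr (proxy_equiv% (TriVertex l r))]
  simp
  ring

variable {T : Type*}

/-- The edges of the triangle construction. The triangle of index `t` has vertices `π a t`, and its
edge opposite to `π a t` is present if `w a t = true`. -/
def rel (π : Fin 3 → T → Fin l) (w : Fin 3 → T → Bool) : TriVertex l r → TriVertex l r → Prop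
  | core a i, core b j => a ≠ b ∧ ∃ t, π a t = i ∧ π b t = j ∧ ∀ c, c ≠ a → c ≠ b → w c t = true
  | core a i, mid b j => a = b ∧ i = j
  | hub, mid _ _ => True
  | hub, spare _ => True
  | _, _ => False

/-- The graph of the triangle construction. -/
def graph (π : Fin 3 → T → Fin l) (w : Fin 3 → T → Bool) : SimpleGraph (TriVertex l r) :=
  SimpleGraph.fromRel (rel π w)

variable {π : Fin 3 → T → Fin l} {w : Fin 3 → T → Bool}

theorem core_core {a b : Fin 3} {i j : Fin l} :
    (graph π w).Adj (core a i : TriVertex l r) (core b j) ↔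
      a ≠ b ∧ ∃ t, π a t = i ∧ π b t = j ∧ ∀ c, c ≠ a → c ≠ b → w c t = true := by
  simp only [graph, SimpleGraph.fromRel_adj, rel, ne_eq, core.injEq]
  constructor
  · rintro ⟨-, h | ⟨hab, t, h1, h2, h3⟩⟩
    · exact h
    · exact ⟨fun h => hab h.symm, t, h2, h1, fun c ha hb => h3 c hb ha⟩
  · exact fun h => ⟨fun h' => h.1 h'.1, .inl h⟩

theorem core_mid {a b : Fin 3} {i j : Fin l} :
    (graph π w).Adj (core a i : TriVertex l r) (mid b j) ↔ a = b ∧ i = j := by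
  simp [graph, rel]

theorem hub_mid (b : Fin 3) (j : Fin l) :
    (graph π w).Adj (hub : TriVertex l r) (mid b j) := by
  simp [graph, rel]

theorem hub_spare (j : Fin r) : (graph π w).Adj (hub : TriVertex l r) (spare j) := by
  simp [graph, rel]

theorem connected : (graph π w : SimpleGraph (TriVertex l r)).Connected := by
  rw [SimpleGraph.connected_iff_exists_forall_reachable]
  refine ⟨hub, fun v => ?_⟩
  cases v with
  | core a i => exact (hub_mid a i).reachable.trans (core_mid.2 ⟨rfl, rfl⟩).symm.reachable
  | mid a i => exact (hub_mid a i).reachable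
  | spare j => exact (hub_spare j).reachable
  | hub => exact .rfl

/-- Every vertex outside the core has an independent neighbourhood. -/
theorem exists_core_of_triangle {u v x : TriVertex l r} (h1 : (graph π w).Adj u v)
    (h2 : (graph π w).Adj v x) (h3 : (graph π w).Adj u x) : ∃ a i, u = core a i := by
  cases u with
  | core a i => exact ⟨a, i, rfl⟩
  | mid a i => cases v <;> cases x <;> simp [graph, rel] at h1 h2 h3; omega
  | spare j => cases v <;> cases x <;> simp [graph, rel] at h1 h2 h3
  | hub => cases v <;> cases x <;> simp [graph, rel] at h1 h2 h3

/-- The triangles `π · t` are edge-disjoint and there are no others. -/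
def NoAccident (π : Fin 3 → T → Fin l) : Prop :=
  ∀ τ : Fin 3 → T, (∀ a b c, b ≠ a → c ≠ a → π a (τ b) = π a (τ c)) → ∀ b c, τ b = τ c

theorem fin_three_cases {a b c : Fin 3} (hab : a ≠ b) (hac : a ≠ c) (hbc : b ≠ c) (e : Fin 3) :
    e = a ∨ e = b ∨ e = c := by
  revert a b c e
  decide

/-- A triangle has one core vertex in each class, and each of its edges comes from some index.
`NoAccident` makes the three indices equal, so all three bits at that index would be `true`. -/
theorem cliqueFree (hπ : NoAccident π) (hw : ∀ t, ∃ c, w c t = false) :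
    (graph π w : SimpleGraph (TriVertex l r)).CliqueFree 3 := by
  intro s hs
  obtain ⟨u, v, x, huv, hux, hvx, -⟩ := SimpleGraph.is3Clique_iff.1 hs
  obtain ⟨a, i, rfl⟩ := exists_core_of_triangle huv hvx hux
  obtain ⟨b, j, rfl⟩ := exists_core_of_triangle huv.symm hux hvx
  obtain ⟨c, k, rfl⟩ := exists_core_of_triangle hux.symm huv hvx.symm
  have hab := (core_core.1 huv).1
  have hac := (core_core.1 hux).1
  have hbc := (core_core.1 hvx).1
  have hall := fin_three_cases hab hac hbc
  obtain ⟨ι, hι⟩ : ∃ ι : Fin 3 → Fin l, ∀ e f, e ≠ f →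
      (graph π w).Adj (core e (ι e) : TriVertex l r) (core f (ι f)) := by
    refine ⟨fun e => if e = a then i else if e = b then j else k, fun e f hef => ?_⟩
    rcases hall e with rfl | rfl | rfl <;> rcases hall f with rfl | rfl | rfl <;>
      simp_all [SimpleGraph.adj_comm, Ne.symm]
  have hτ : ∀ e, ∃ t, (∀ f, f ≠ e → π f t = ι f) ∧ w e t = true := by
    intro e
    have h12 : e + 1 ≠ e + 2 := by revert e; decide
    have h01 : e ≠ e + 1 := by revert e; decide
    have h02 : e ≠ e + 2 := by revert e; decide
    obtain ⟨-, t, h1, h2, h3⟩ := core_core.1 (hι (e + 1) (e + 2) h12)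
    refine ⟨t, fun f hf => ?_, h3 e h01 h02⟩
    rcases fin_three_cases h01 h02 h12 f with rfl | rfl | rfl
    exacts [absurd rfl hf, h1, h2]
  choose τ hτ hwτ using hτ
  have heq := hπ τ fun a b c hb hc => (hτ b a hb.symm).trans (hτ c a hc.symm).symm
  obtain ⟨e, he⟩ := hw (τ 0)
  have := hwτ e
  rw [heq e 0, he] at this
  exact Bool.false_ne_true this

theorem not_cliqueFree {t : T} (hw : ∀ c, w c t = true) :
    ¬ (graph π w : SimpleGraph (TriVertex l r)).CliqueFree 3 := by
  have hadj : ∀ a b, a ≠ b →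
      (graph π w).Adj (core a (π a t) : TriVertex l r) (core b (π b t)) :=
    fun a b hab => core_core.2 ⟨hab, t, rfl, rfl, fun c _ _ => hw c⟩
  intro h
  exact h _ (SimpleGraph.is3Clique_iff.2 ⟨_, _, _, hadj 0 1 (by decide), hadj 0 2 (by decide),
    hadj 1 2 (by decide), rfl⟩)

/-- The class of a core vertex; other vertices are put into class `0`. -/
def cls : TriVertex l r → Fin 3
  | core a _ => a
  | _ => 0

/-- A vertex does not see the edges opposite to its class. -/
theorem adj_congr {w' : Fin 3 → T → Bool} {v : TriVertex l r}
    (h : ∀ c, c ≠ cls v → w c = w' c) (u : TriVertex l r) :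
    (graph π w).Adj v u ↔ (graph π w').Adj v u := by
  cases v with
  | core a i =>
    cases u with
    | core b j =>
      rw [core_core, core_core]
      refine and_congr_right fun _ => exists_congr fun t => and_congr_right fun _ =>
        and_congr_right fun _ => forall_congr' fun c => forall_congr' fun hc => ?_
      rw [h c hc]
    | _ => simp [graph, rel]
  | _ => cases u <;> simp [graph, rel]

end TriVertex

theorem unlabelled_mem_triangleFreeLang {n : ℕ} {V : Type*} (e : V ≃ Fin n) (G : SimpleGraph V)
    (hG : G.Connected) : unlabelled e G hG ∈ triangleFreeLang n ↔ G.CliqueFree 3 :=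
  ⟨fun h => h.comap (unlabelledIso e G hG).symm.isContained,
    fun h => h.comap (unlabelledIso e G hG).isContained⟩

/-- A lower bound in terms of a tripartite graph all of whose edges lie in exactly one triangle. -/
theorem pow_le_of_decides_triangleFreeLang {k b n c d l r : ℕ} (hc : 1 ≤ c) {V : Verifier k b}
    (hV : V.Decides (1 / 3) (polyNetworks c d n) (triangleFreeLang n))
    (hn : 6 * l + r + 1 = n) {T : Type*} [Fintype T] {π : Fin 3 → T → Fin l}
    (hπ : TriVertex.NoAccident π) :
    (225 : ℝ) ^ Fintype.card T ≤
      ((2 : ℝ) ^ (2 ^ (b * (k / 2 + 1)) * n)) ^ 2 * 224 ^ Fintype.card T := by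
  classical
  by_contra! hlt
  let e : TriVertex l r ≃ Fin n := Fintype.equivFinOfCardEq (TriVertex.card.trans hn)
  let net : (Fin 3 → T → Bool) → Network n := fun w =>
    unlabelled e (TriVertex.graph π w) TriVertex.connected
  have hP : ∀ w, net w ∈ polyNetworks c d n := fun w => unlabelled_mem_polyNetworks e _ _ d hc
  obtain ⟨sig, hsig⟩ := hV.exists_signature Finset.univ
  have hne : (Finset.univ : Finset (Fin n)).Nonempty := ⟨e .hub, Finset.mem_univ _⟩
  have hcard : (Fintype.card (Signature k b (Finset.univ : Finset (Fin n))) : ℝ) ≤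
      2 ^ (2 ^ (b * (k / 2 + 1)) * n) := by
    have := card_signature_le k b _ hne
    rw [Finset.card_univ, Fintype.card_fin] at this
    exact_mod_cast this
  obtain ⟨x, y, z, x', y', z', hxyz, hx, hy, hz, hs1, hs2⟩ := exists_monochromatic_star
    (fun x y z => sig (net ![x, y, z]))
    ((mul_le_mul_of_nonneg_right (pow_le_pow_left₀ (by positivity) hcard 2)
      (by positivity)).trans_lt hlt)
  have hyes : ∀ x y z : T → Bool, NoCommon x y z → net ![x, y, z] ∈ triangleFreeLang n := by
    intro x y z h
    rw [unlabelled_mem_triangleFreeLang]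
    refine TriVertex.cliqueFree hπ fun t => ?_
    have := h t
    by_contra! hall
    have h0 : x t ≠ false := hall 0
    have h1 : y t ≠ false := hall 1
    have h2 : z t ≠ false := hall 2
    simp_all
  -- A node of class `a` does not see the family `w a`, so it may live in the arm of the star where
  -- that family is changed.
  let ws : Fin 3 → Network n := ![net ![x', y, z], net ![x, y', z], net ![x, y, z']]
  have hmem : net ![x, y, z] ∈ triangleFreeLang n := by
    refine hsig _ (fun v => ws (e.symm v).cls) (hP _) ?_ ?_ ?_ ?_ ?_
      fun _ u _ hu => absurd (Finset.mem_univ u) hu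
    · intro v
      generalize (e.symm v).cls = a
      fin_cases a
      exacts [⟨hP _, hyes _ _ _ hx⟩, ⟨hP _, hyes _ _ _ hy⟩, ⟨hP _, hyes _ _ _ hz⟩]
    · intro v
      generalize (e.symm v).cls = a
      fin_cases a <;> rfl
    · intro v
      generalize (e.symm v).cls = a
      fin_cases a <;> rfl
    · intro v u
      have h (w') := TriVertex.adj_congr (π := π) (v := e.symm v) (w := ![x, y, z]) (w' := w')
      generalize (e.symm v).cls = a at h
      fin_cases a
      · refine (h ![x', y, z] (fun c hc => ?_) (e.symm u)).symm
        fin_cases c <;> first | rfl | exact absurd rfl hc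
      · refine (h ![x, y', z] (fun c hc => ?_) (e.symm u)).symm
        fin_cases c <;> first | rfl | exact absurd rfl hc
      · refine (h ![x, y, z'] (fun c hc => ?_) (e.symm u)).symm
        fin_cases c <;> first | rfl | exact absurd rfl hc
    · have h0 : ∀ a, sig (ws a) = sig (ws 0) := by
        intro a
        fin_cases a
        exacts [rfl, hs1.symm, hs2.symm]
      intro v u
      exact (h0 _).trans (h0 _).symm
  rw [unlabelled_mem_triangleFreeLang] at hmem
  simp only [NoCommon, not_forall, Bool.not_eq_false, Bool.and_eq_true] at hxyz
  obtain ⟨t, ⟨h0, h1⟩, h2⟩ := hxyz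
  refine TriVertex.not_cliqueFree (t := t) (fun c => ?_) hmem
  fin_cases c
  exacts [h0, h1, h2]

/-- Ruzsa–Szemerédi systems of triangles, from sets without three-term progressions. -/
theorem exists_noAccident (N : ℕ) : ∃ π : Fin 3 → Fin (N * rothNumberNat N) → Fin (3 * N),
    TriVertex.NoAccident π := by
  obtain ⟨A, hA, hcard, hfree⟩ := rothNumberNat_spec N
  have hlt : ∀ a : A, (a : ℕ) < N := fun a => Finset.mem_range.1 (hA a.2)
  let e : Fin (N * rothNumberNat N) ≃ Fin N × A :=
    Fintype.equivOfCardEq (by simp [hcard])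
  let ρ : Fin 3 → Fin N × A → Fin (3 * N) := fun c t =>
    ⟨t.1 + c * t.2, by
      have h1 := t.1.2
      have h2 := hlt t.2
      have h3 : (c : ℕ) * t.2 ≤ 2 * t.2 := Nat.mul_le_mul_right _ (by omega)
      omega⟩
  refine ⟨fun c t => ρ c (e t), fun τ hτ => ?_⟩
  have h0 := congrArg Fin.val (hτ 0 1 2 (by decide) (by decide))
  have h1 := congrArg Fin.val (hτ 1 0 2 (by decide) (by decide))
  have h2 := congrArg Fin.val (hτ 2 0 1 (by decide) (by decide))
  simp only [ρ, Fin.val_zero, Fin.val_one, Fin.val_two, zero_mul, add_zero, one_mul] at h0 h1 h2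
  -- Eliminating the first coordinates from the three equations leaves `a₀ + a₂ = 2 * a₁` for the
  -- elements of `A`.
  have h3 := hfree (e (τ 0)).2.2 (e (τ 1)).2.2 (e (τ 2)).2.2 (by omega)
  have h4 : e (τ 0) = e (τ 1) := by
    refine Prod.ext (Fin.ext ?_) (Subtype.ext h3)
    omega
  have h5 : e (τ 1) = e (τ 2) := by
    refine Prod.ext (Fin.ext ?_) (Subtype.ext ?_) <;> omega
  have h6 := e.injective h4
  have h7 := e.injective h5
  intro b c
  fin_cases b <;> fin_cases c <;> simp_all

/-- Once `log N ≥ 64`, the loss `4 * √(log N)` in Behrend's exponent is at most `log N / 2`. -/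
theorem sqrt_le_rothNumberNat {N : ℕ} (hN : Real.exp 64 ≤ N) : √(N : ℝ) ≤ rothNumberNat N := by
  have hpos : (0 : ℝ) < N := (Real.exp_pos _).trans_le hN
  refine le_trans ?_ Behrend.roth_lower_bound
  have hL : 64 ≤ Real.log N := (Real.le_log_iff_exp_le hpos).2 hN
  have h8 : 8 ≤ √(Real.log N) := Real.le_sqrt_of_sq_le (by linarith)
  have hsq := Real.mul_self_sqrt (show 0 ≤ Real.log N by linarith)
  calc √(N : ℝ) = Real.exp (Real.log N / 2) := by
        rw [Real.sqrt_eq_rpow, Real.rpow_def_of_pos hpos]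
        ring_nf
    _ ≤ Real.exp (Real.log N + -4 * √(Real.log N)) := by
        apply Real.exp_le_exp.2
        nlinarith
    _ = N * Real.exp (-4 * √(Real.log N)) := by rw [Real.exp_add, Real.exp_log hpos]

theorem needsBandwidth_triangleFreeLang (k c d : ℕ) (hc : 1 ≤ c) :
    NeedsBandwidth (1 / 3) k (polyNetworks c d) triangleFreeLang (fun n => Real.log n) := by
  have hq : 0 < Real.log (225 / 224) := Real.log_pos (by norm_num)
  apply needsBandwidth_log_of_rpow_le (a := Real.log (225 / 224) / (37 ^ 2 * 2))
    (δ := 1 / 2) (k / 2 + 1) (by positivity) (by norm_num) (by positivity)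
  filter_upwards [(tendsto_natCast_atTop_atTop (R := ℝ)).eventually_ge_atTop (37 * Real.exp 64),
    eventually_ge_atTop 19] with n hn hn' b V hV
  obtain ⟨N, r, hr, hnN⟩ : ∃ N r, r < 18 ∧ 6 * (3 * N) + r + 1 = n :=
    ⟨(n - 1) / 18, (n - 1) % 18, Nat.mod_lt _ (by norm_num), by omega⟩
  have hN1 : n ≤ 37 * N := by omega
  have hN2 : (n : ℝ) ≤ 37 * N := by exact_mod_cast hN1
  have hNpos : (0 : ℝ) < N := by
    have : 0 < N := by omega
    exact_mod_cast this
  have hNn : (N : ℝ) ≤ n := by exact_mod_cast (by omega : N ≤ n)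
  obtain ⟨π, hπ⟩ := exists_noAccident N
  have h := pow_le_of_decides_triangleFreeLang hc hV hnN hπ
  rw [Fintype.card_fin] at h
  have hroth := sqrt_le_rothNumberNat (N := N) (by linarith)
  -- Taking logarithms compares about `N ^ (3/2)` triangles with `2 ^ O(b) * n`; one factor `N`
  -- cancels below, leaving the exponent `1 / 2`.
  have h1 : (N * √(N : ℝ)) * Real.log (225 / 224) ≤ 2 * (2 ^ (b * (k / 2 + 1)) * n) := by
    rw [← div_le_iff₀ (by positivity), ← div_pow, ← pow_mul] at h
    have h2 := Real.log_le_log (by positivity) h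
    rw [Real.log_pow, Real.log_pow] at h2
    push_cast at h2
    have h3 : Real.log 2 ≤ 1 := by linarith [Real.log_two_lt_d9]
    calc (N * √(N : ℝ)) * Real.log (225 / 224)
        ≤ (N * rothNumberNat N) * Real.log (225 / 224) := by gcongr
      _ ≤ _ := h2
      _ ≤ (2 ^ (b * (k / 2 + 1)) * n * 2) * 1 := by gcongr
      _ = _ := by ring
  have h2 : √(n : ℝ) ≤ 37 * √(N : ℝ) := by
    apply Real.sqrt_le_iff.2 ⟨by positivity, ?_⟩
    rw [mul_pow, Real.sq_sqrt hNpos.le]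
    linarith
  rw [← Real.sqrt_eq_rpow, div_mul_eq_mul_div, div_le_iff₀ (by norm_num)]
  refine le_of_mul_le_mul_left ?_ hNpos
  calc N * (Real.log (225 / 224) * √(n : ℝ)) ≤ N * (Real.log (225 / 224) * (37 * √(N : ℝ))) := by
        gcongr
    _ = 37 * ((N * √(N : ℝ)) * Real.log (225 / 224)) := by ring
    _ ≤ 37 * (2 * (2 ^ (b * (k / 2 + 1)) * n)) := by gcongr
    _ ≤ 37 * (2 * (2 ^ (b * (k / 2 + 1)) * (37 * N))) := by gcongr
    _ = N * (2 ^ (b * (k / 2 + 1)) * (37 ^ 2 * 2)) := by ring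

end DistIP

theorem mainTheorem11 (k : ℕ) (hk : 1 ≤ k) (c d : ℕ) (hc : 1 ≤ c) :
    DistIP.NeedsBandwidth (1 / 3) k (DistIP.polyNetworks c d) DistIP.symmetryLang
        (fun n => Real.log n) ∧
    (∀ D : ℕ, 2 ≤ D →
      DistIP.NeedsBandwidth (1 / 3) k (DistIP.polyNetworks c d) (DistIP.diameterLang D)
        (fun n => Real.log n)) ∧
    DistIP.NeedsBandwidth (1 / 3) k (DistIP.polyNetworks c d) DistIP.nonThreeColLang
        (fun n => Real.log n) ∧
    DistIP.NeedsBandwidth (1 / 3) k (DistIP.polyNetworks c d) DistIP.triangleFreeLang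
        (fun n => Real.log n) ∧
    (∀ e : ℕ, 1 ≤ d → 1 ≤ e →
      DistIP.NeedsBandwidth (1 / 3) k (DistIP.weightedNetworks c d e) DistIP.mstLang
        (fun n => Real.log (Real.log n))) := by
  exact ⟨DistIP.needsBandwidth_symmetryLang k c d hc,
    fun D hD => DistIP.needsBandwidth_diameterLang k c d D hc hD,
    DistIP.needsBandwidth_nonThreeColLang k c d hc,
    DistIP.needsBandwidth_triangleFreeLang k c d hc,
    fun e hd he => DistIP.needsBandwidth_mstLang k c d e hc hd he⟩
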